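/- Let $p_n$ denote the $n$th prime. For an integer $n\ge 1$ put $\varpi(n)=\log n$ if $n$ is prime and $\varpi(n)=0$ otherwise, and for real $y>0$ and integers $a,q$ with $q\ge 1$ put $$\vartheta^*(y;a,q)=\sum_{\substack{y<n\le 2y\\ n\equiv a \,(\mathrm{mod}\, q)}}\varpi(n).$$ For each real $\theta$ with $\tfrac12<\theta<1$ there is a constant $c(\theta)$, depending only on $\theta$, such that the following holds. Suppose that for every fixed $A>0$ there is a constant $C_A$, depending only on $A$ (for this $\theta$), such that for all real $x\ge 2$ $$\sum_{1\le q\le x^\theta}\ \sup_{0<y\le x}\ \max_{\substack{a\\ (a,q)=1}}\left|\vartheta^*(y;a,q)-\frac{y}{\varphi(q)}\right|\le C_A\,\frac{x}{(\log x)^A},$$ where $\varphi$ is Euler's function and $y$ runs over real numbers. Then $p_{n+1}-p_n\le c(\theta)$ for infinitely many $n$. -/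

import Mathlib

open scoped ENNReal

noncomputable section

/-- `ϖ(n) = log n` if `n` is prime, and `0` otherwise. -/
def primeLog (n : ℕ) : ℝ :=
  if n.Prime then Real.log n else 0

/-- `ϑ*(y; a, q)`: the sum of `ϖ(n)` over the integers `n` with `y < n ≤ 2y` and
`n ≡ a (mod q)`, for real `y ≥ 0`. -/
def thetaStar (y : ℝ) (a q : ℕ) : ℝ :=
  ∑ n ∈ (Finset.Ioc ⌊y⌋₊ ⌊2 * y⌋₊).filter (fun n => n ≡ a [MOD q]), primeLog n

/-- The error `|ϑ*(y; a, q) - y / φ(q)|`, maximised over real `0 < y ≤ x` and over the residue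
classes `a` coprime to `q`. The supremum is taken in `[0, ∞]`, so that it is a true supremum. -/
def maxError (x : ℝ) (q : ℕ) : ℝ≥0∞ :=
  ⨆ (y : ℝ) (_ : 0 < y ∧ y ≤ x) (a : ℕ) (_ : a.Coprime q),
    ENNReal.ofReal |thetaStar y a q - y / (Nat.totient q : ℝ)|

/-- The primes have level of distribution `θ`: for every fixed `A > 0` there is a constant `C`
(depending only on `A`) such that for all real `x ≥ 2`
`∑_{q ≤ x^θ} max_{y ≤ x} max_{(a,q)=1} |ϑ*(y; a, q) - y / φ(q)| ≤ C x / (log x)^A`. -/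
def HasLevelOfDistribution (θ : ℝ) : Prop :=
  ∀ A : ℝ, 0 < A → ∃ C : ℝ, ∀ x : ℝ, 2 ≤ x →
    ∑ q ∈ Finset.Icc 1 ⌊x ^ θ⌋₊, maxError x q ≤ ENNReal.ofReal (C * (x / Real.log x ^ A))

end

/-! The argument is that of Goldston, Pintz and Yıldırım, with Selberg's diagonalisation in place of
contour integrals. Fix `W = D!` and consider the tuples `n + i W`, `i < k`, with `n ≡ 1 (mod W)`. If
no tuple beyond `n₀` contained two primes, then for any real `Λ(n)` the sum over `i` and `n` of `ϖ(n
+ i W) Λ(n)²`, with `N < n + i W ≤ 2N`, would be at most `log(2N) ∑ Λ(n)²`. A choice of `Λ`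
violating this for some large `N` yields two primes less than `k W` apart.

Here `Λ(n)` is `sieveSum`: weights `w(s)` summed over sets `s` of primes up to `R`, not dividing
`W`, each of which divides some member of the tuple. Opening the square gives quadratic forms in `w`
with local densities `k/p` (all `n`) and `(k-1)/(p-1)` (one member prime). `quadraticForm_eq_sum_sq`
diagonalises both. The weights are chosen so that the variables of the first form are, up to
explicit local factors, `(log (R/∏p))^l`; those of the second are then at least about `(φ(W)/W) (log
(R/∏p))^(l+1)/(l+1)`. Hence `quadraticForm_le` bounds the first form above, and
`quadraticForm_prime_ge` the second below, by the elementary sums `coprimeSum`, which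
`coprimeSum_asymptotic` evaluates.

With `k = (2l+1)²` and `R = N^(τ/2)`, the ratio of the main terms is `(τ/2) ((2l+1)/(l+1))²
exp(-2k²/D)`. For large `l`, and then large `D`, this is close to `2τ`, which exceeds 1 because `1/2
< τ < θ`.

The moduli that occur are at most `W R² ≤ N^θ`, so the level of distribution controls the errors for
primes. The divisor-like weights on them are removed by Cauchy-Schwarz and the trivial bound
`maxError_le`. -/

section BoundedGaps

open Finset

/-! ### Truncated powers of the logarithm -/

/-- The truncated power of the logarithm: `(log x) ^ j` for `x ≥ 1`, and `0` for `x < 1`. -/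
noncomputable def truncLog (j : ℕ) (x : ℝ) : ℝ :=
  if 1 ≤ x then Real.log x ^ j else 0

lemma truncLog_of_one_le {j : ℕ} {x : ℝ} (hx : 1 ≤ x) : truncLog j x = Real.log x ^ j := if_pos hx

lemma truncLog_of_lt_one {j : ℕ} {x : ℝ} (hx : x < 1) : truncLog j x = 0 := if_neg hx.not_ge

lemma truncLog_nonneg (j : ℕ) (x : ℝ) : 0 ≤ truncLog j x := by
  unfold truncLog
  split_ifs with h
  · exact pow_nonneg (Real.log_nonneg h) j
  · exact le_rfl

lemma truncLog_mono (j : ℕ) : Monotone (truncLog j) := by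
  intro x y hxy
  rcases lt_or_ge x 1 with hx | hx
  · rw [truncLog_of_lt_one hx]
    exact truncLog_nonneg j y
  · rw [truncLog_of_one_le hx, truncLog_of_one_le (hx.trans hxy)]
    exact pow_le_pow_left₀ (Real.log_nonneg hx) (Real.log_le_log (by linarith) hxy) j

lemma truncLog_sq (j : ℕ) (x : ℝ) : truncLog j x ^ 2 = truncLog (2 * j) x := by
  unfold truncLog
  split_ifs with h
  · rw [← pow_mul, mul_comm]
  · norm_num

lemma pow_succ_sub_pow_succ_le {a b : ℝ} (hb : 0 ≤ b) (hab : b ≤ a) (j : ℕ) :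
    a ^ (j + 1) - b ^ (j + 1) ≤ (j + 1) * a ^ j * (a - b) := by
  induction j with
  | zero => simp
  | succ j ih =>
    have h1 : b ^ (j + 1) ≤ a ^ (j + 1) := pow_le_pow_left₀ hb hab _
    have h2 := mul_le_mul_of_nonneg_left ih (hb.trans hab)
    have h3 := mul_le_mul_of_nonneg_right h1 (sub_nonneg.2 hab)
    push_cast
    calc a ^ (j + 1 + 1) - b ^ (j + 1 + 1)
        = a * (a ^ (j + 1) - b ^ (j + 1)) + b ^ (j + 1) * (a - b) := by ring
      _ ≤ a * ((j + 1) * a ^ j * (a - b)) + a ^ (j + 1) * (a - b) := add_le_add h2 h3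
      _ = _ := by ring

lemma le_pow_succ_sub_pow_succ {a b : ℝ} (hb : 0 ≤ b) (hab : b ≤ a) (j : ℕ) :
    (j + 1) * b ^ j * (a - b) ≤ a ^ (j + 1) - b ^ (j + 1) := by
  induction j with
  | zero => simp
  | succ j ih =>
    have h1 : b ^ (j + 1) ≤ a ^ (j + 1) := pow_le_pow_left₀ hb hab _
    have h2 := mul_le_mul_of_nonneg_left ih hb
    have h3 := mul_le_mul_of_nonneg_right h1 (sub_nonneg.2 hab)
    push_cast
    calc (j + 1 + 1) * b ^ (j + 1) * (a - b)
        = b * ((j + 1) * b ^ j * (a - b)) + b ^ (j + 1) * (a - b) := by ring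
      _ ≤ b * (a ^ (j + 1) - b ^ (j + 1)) + a ^ (j + 1) * (a - b) := add_le_add h2 h3
      _ = _ := by ring

/-- Up to the factor `-(j+1)`, `t ↦ truncLog (j+1) (x/t)` is a primitive of `t ↦ truncLog j (x/t) /
t`. This lemma and the next bound its increments by the two endpoint values, so that sums of the
latter function telescope. -/
lemma truncLog_sub_le {x s t : ℝ} (hx : 0 < x) (hs : 0 < s) (hst : s ≤ t) (j : ℕ) :
    truncLog (j + 1) (x / s) - truncLog (j + 1) (x / t)
      ≤ (j + 1) * ((t - s) / s) * truncLog j (x / s) := by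
  have ht : 0 < t := hs.trans_le hst
  rcases lt_or_ge (x / s) 1 with h | h
  · rw [truncLog_of_lt_one h, truncLog_of_lt_one h]
    linarith [truncLog_nonneg (j + 1) (x / t)]
  · rw [truncLog_of_one_le h, truncLog_of_one_le h]
    -- Since `j + 1 > 0`, truncating amounts to taking the positive part of the logarithm, which
    -- treats both ranges of `x / t` at once.
    have hB : truncLog (j + 1) (x / t) = (max 0 (Real.log (x / t))) ^ (j + 1) := by
      rcases lt_or_ge (x / t) 1 with h' | h'
      · rw [truncLog_of_lt_one h', max_eq_left (Real.log_nonpos (by positivity) h'.le)]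
        simp
      · rw [truncLog_of_one_le h', max_eq_right (Real.log_nonneg h')]
    have hA := Real.log_nonneg h
    have hlog : Real.log (x / t) = Real.log (x / s) - Real.log (t / s) := by
      rw [← Real.log_div (by positivity) (by positivity)]
      congr 1
      field_simp
    have h1 : Real.log (t / s) ≤ (t - s) / s := by
      have := Real.log_le_sub_one_of_pos (show 0 < t / s by positivity)
      rwa [sub_div, div_self hs.ne']
    have h2 : 0 ≤ Real.log (t / s) := Real.log_nonneg ((one_le_div hs).2 hst)
    rw [hB]
    have hm : max 0 (Real.log (x / t)) ≤ Real.log (x / s) := max_le hA (by linarith)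
    refine (pow_succ_sub_pow_succ_le (le_max_left _ _) hm j).trans ?_
    have h3 : Real.log (x / s) - max 0 (Real.log (x / t)) ≤ (t - s) / s := by
      have := le_max_right 0 (Real.log (x / t))
      linarith
    calc _ ≤ (j + 1) * Real.log (x / s) ^ j * ((t - s) / s) := by gcongr
      _ = _ := by ring

lemma le_truncLog_sub {x s t : ℝ} (hx : 0 < x) (hs : 0 < s) (hst : s ≤ t) (j : ℕ) :
    (j + 1) * ((t - s) / t) * truncLog j (x / t)
      ≤ truncLog (j + 1) (x / s) - truncLog (j + 1) (x / t) := by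
  have ht : 0 < t := hs.trans_le hst
  have hle : x / t ≤ x / s := by gcongr
  rcases lt_or_ge (x / t) 1 with h | h
  · have := truncLog_mono (j + 1) hle
    rw [truncLog_of_lt_one h]
    linarith
  · rw [truncLog_of_one_le h, truncLog_of_one_le h, truncLog_of_one_le (h.trans hle)]
    have hB := Real.log_nonneg h
    have hlog : Real.log (x / s) = Real.log (x / t) + Real.log (t / s) := by
      rw [← Real.log_mul (by positivity) (by positivity)]
      congr 1
      field_simp
    have h1 : (t - s) / t ≤ Real.log (t / s) := by
      have := Real.one_sub_inv_le_log_of_pos (show 0 < t / s by positivity)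
      rwa [inv_div, ← div_self ht.ne', ← sub_div] at this
    have h2 : 0 ≤ Real.log (t / s) := Real.log_nonneg ((one_le_div hs).2 hst)
    refine le_trans ?_ (le_pow_succ_sub_pow_succ hB (a := Real.log (x / s)) (by linarith) j)
    rw [hlog, add_sub_cancel_left]
    calc (j + 1) * ((t - s) / t) * Real.log (x / t) ^ j
        = (j + 1) * Real.log (x / t) ^ j * ((t - s) / t) := by ring
      _ ≤ _ := by gcongr

/-! ### Logarithmic sums over integers coprime to `W` -/

/-- Block comparison: an antitone function summed over the integers coprime to `W`. -/
lemma sum_coprime_blocks (W : ℕ) (h : ℕ → ℝ) (hh : ∀ m n, 1 ≤ m → m ≤ n → h n ≤ h m) (B : ℕ) :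
    W.totient * ∑ a ∈ range B, h (a * W + W) ≤ ∑ r ∈ Ico 1 (B * W + 1) with W.Coprime r, h r ∧
    ∑ r ∈ Ico 1 (B * W + 1) with W.Coprime r, h r ≤ W.totient * ∑ a ∈ range B, h (a * W + 1) := by
  have key : ∀ a : ℕ, W.totient * h (a * W + W) ≤
      ∑ r ∈ Ico (a * W + 1) (a * W + 1 + W) with W.Coprime r, h r ∧
      ∑ r ∈ Ico (a * W + 1) (a * W + 1 + W) with W.Coprime r, h r ≤
        W.totient * h (a * W + 1) := by
    intro a
    have hc := Nat.filter_coprime_Ico_eq_totient W (a * W + 1)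
    constructor
    · rw [← hc, ← nsmul_eq_mul]
      refine card_nsmul_le_sum _ _ _ fun r hr => ?_
      simp only [mem_filter, mem_Ico] at hr
      exact hh _ _ (by omega) (by omega)
    · rw [← hc, ← nsmul_eq_mul]
      refine sum_le_card_nsmul _ _ _ fun r hr => ?_
      simp only [mem_filter, mem_Ico] at hr
      exact hh _ _ (by omega) (by omega)
  induction B with
  | zero => simp
  | succ B ih =>
    have hsplit : ∑ r ∈ Ico 1 ((B + 1) * W + 1) with W.Coprime r, h r =
        ∑ r ∈ Ico 1 (B * W + 1) with W.Coprime r, h r +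
        ∑ r ∈ Ico (B * W + 1) (B * W + 1 + W) with W.Coprime r, h r := by
      rw [sum_filter, sum_filter, sum_filter, sum_Ico_consecutive _ (by omega) (by omega)]
      congr 2
      ring
    rw [hsplit, sum_range_succ, sum_range_succ, mul_add, mul_add]
    exact ⟨add_le_add ih.1 (key B).1, add_le_add ih.2 (key B).2⟩

lemma sum_truncLog_extend {f : ℕ → ℝ} {x : ℝ} (hx : 0 ≤ x) (j : ℕ) (W : ℕ) {S : Finset ℕ}
    (hS : Icc 1 ⌊x⌋₊ ⊆ S) (hpos : ∀ n ∈ S, 1 ≤ n) :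
    ∑ r ∈ Icc 1 ⌊x⌋₊ with W.Coprime r, f r * truncLog j (x / r) =
      ∑ r ∈ S with W.Coprime r, f r * truncLog j (x / r) := by
  refine sum_subset (filter_subset_filter _ hS) fun r hr hr' => ?_
  simp only [mem_filter, mem_Icc, not_and] at hr hr'
  have h1 := hpos r hr.1
  have h2 : ¬ r ≤ ⌊x⌋₊ := fun h => hr' ⟨h1, h⟩ hr.2
  have h3 : x < r := by
    rw [not_le] at h2
    exact (Nat.floor_lt hx).1 h2
  rw [truncLog_of_lt_one, mul_zero]
  rw [div_lt_one]
  · exact h3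
  · exact_mod_cast h1

/-- The sum of `(1/r) (log (x/r))^j` over `r ≤ x` coprime to `W`. -/
lemma sum_coprime_truncLog {W : ℕ} (hW : 0 < W) (j : ℕ) {x : ℝ} (hx : 1 ≤ x) :
    |∑ r ∈ Icc 1 ⌊x⌋₊ with W.Coprime r, (1 / (r : ℝ)) * truncLog j (x / r) -
      W.totient / W * (Real.log x ^ (j + 1) / (j + 1))| ≤ W * Real.log x ^ j := by
  have hx0 : 0 < x := by linarith
  have hWr : (0 : ℝ) < W := by exact_mod_cast hW
  -- The terms beyond `x` vanish, so the sum may be extended to complete blocks of length `W`; `B`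
  -- blocks reach past `x`.
  set B := ⌊x⌋₊ + 1 with hBdef
  have hBW : B ≤ B * W := Nat.le_mul_of_pos_right _ hW
  rw [sum_truncLog_extend (f := fun r => 1 / (r : ℝ)) hx0.le j W (S := Ico 1 (B * W + 1))
    (fun r hr => by simp only [mem_Icc, mem_Ico] at hr ⊢; omega)
    (fun n hn => (mem_Ico.1 hn).1)]
  have hanti : ∀ m n : ℕ, 1 ≤ m → m ≤ n →
      (1 / (n : ℝ)) * truncLog j (x / n) ≤ (1 / (m : ℝ)) * truncLog j (x / m) := by
    intro m n hm hmn
    have hm' : (0 : ℝ) < m := by exact_mod_cast hm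
    have hmn' : (m : ℝ) ≤ n := by exact_mod_cast hmn
    have h1 : truncLog j (x / n) ≤ truncLog j (x / m) := truncLog_mono j (by gcongr)
    have h2 := truncLog_nonneg j (x / n)
    gcongr
  obtain ⟨hlo, hhi⟩ := sum_coprime_blocks W _ hanti B
  set G : ℝ → ℝ := fun t => truncLog (j + 1) (x / t) with hG
  have hGnn : ∀ t, 0 ≤ G t := fun t => truncLog_nonneg _ _
  have hL : 0 ≤ Real.log x := Real.log_nonneg hx
  have hG1 : G 1 = Real.log x ^ (j + 1) := by simp [hG, truncLog_of_one_le hx]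
  have hφ : (W.totient : ℝ) ≤ W := by exact_mod_cast Nat.totient_le W
  have hlow : (G W) / ((j + 1) * W) ≤
      ∑ a ∈ range B, (1 / ((a * W + W : ℕ) : ℝ)) * truncLog j (x / (a * W + W : ℕ)) := by
    have hstep : ∀ a : ℕ, (G (a * W + W) - G ((a + 1 : ℕ) * W + W)) / ((j + 1) * W) ≤
        (1 / ((a * W + W : ℕ) : ℝ)) * truncLog j (x / (a * W + W : ℕ)) := by
      intro a
      have := truncLog_sub_le (s := a * W + W) (t := (a + 1 : ℕ) * W + W) hx0 (by positivity)
        (by push_cast; nlinarith) j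
      rw [div_le_iff₀ (by positivity)]
      refine this.trans (le_of_eq ?_)
      push_cast
      field_simp
      ring
    have hend : G (B * W + W) = 0 := by
      refine truncLog_of_lt_one ?_
      rw [div_lt_one (by positivity)]
      have h1 : x < B := by rw [hBdef]; push_cast; exact Nat.lt_floor_add_one x
      have h2 : (B : ℝ) ≤ B * W := by exact_mod_cast hBW
      linarith
    calc (G W) / ((j + 1) * W)
        = ∑ a ∈ range B, (G (a * W + W) - G ((a + 1 : ℕ) * W + W)) / ((j + 1) * W) := by
          rw [← sum_div, sum_range_sub' (fun a : ℕ => G (a * W + W)), hend]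
          simp
      _ ≤ _ := sum_le_sum fun a _ => hstep a
  have hupp : ∑ a ∈ range B, (1 / ((a * W + 1 : ℕ) : ℝ)) * truncLog j (x / (a * W + 1 : ℕ)) ≤
      Real.log x ^ j + G 1 / ((j + 1) * W) := by
    have hstep : ∀ a : ℕ,
        (1 / (((a + 1) * W + 1 : ℕ) : ℝ)) * truncLog j (x / ((a + 1) * W + 1 : ℕ)) ≤
        (G (a * W + 1) - G ((a + 1 : ℕ) * W + 1)) / ((j + 1) * W) := by
      intro a
      have := le_truncLog_sub (s := a * W + 1) (t := (a + 1 : ℕ) * W + 1) hx0 (by positivity)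
        (by push_cast; nlinarith) j
      rw [le_div_iff₀ (by positivity)]
      refine le_trans (le_of_eq ?_) this
      push_cast
      field_simp
      ring
    rw [hBdef, sum_range_succ']
    have h0 : (1 / ((0 * W + 1 : ℕ) : ℝ)) * truncLog j (x / (0 * W + 1 : ℕ)) = Real.log x ^ j := by
      simp [truncLog_of_one_le hx]
    rw [h0, add_comm]
    gcongr
    calc _ ≤ ∑ a ∈ range ⌊x⌋₊, (G (a * W + 1) - G ((a + 1 : ℕ) * W + 1)) / ((j + 1) * W) :=
          sum_le_sum fun a _ => hstep a
      _ = (G 1 - G (⌊x⌋₊ * W + 1)) / ((j + 1) * W) := by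
          rw [← sum_div, sum_range_sub' (fun a : ℕ => G (a * W + 1))]
          simp
      _ ≤ _ := by
          gcongr
          linarith [hGnn (⌊x⌋₊ * W + 1)]
  -- The lower telescoping sum starts at `W` instead of `1`; this is the price, of lower order in
  -- `log x`.
  have hdiff : G 1 - G W ≤ (j + 1) * (W - 1) * Real.log x ^ j := by
    have := truncLog_sub_le (s := 1) (t := W) hx0 one_pos (by exact_mod_cast hW) j
    rw [hG1]
    simpa only [div_one, truncLog_of_one_le hx] using this
  have hp : 0 ≤ Real.log x ^ j := pow_nonneg hL j
  rw [← hG1, abs_le]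
  constructor
  · have h1 : W.totient * ((G W) / ((j + 1) * W)) ≤ _ :=
      (mul_le_mul_of_nonneg_left hlow (by positivity)).trans hlo
    have h2 : (W.totient : ℝ) / W * (G 1 / (j + 1)) - W.totient * ((G W) / ((j + 1) * W))
        = W.totient / W * ((G 1 - G W) / (j + 1)) := by
      field_simp
    have h3 : W.totient / W * ((G 1 - G W) / (j + 1)) ≤ 1 * ((W - 1) * Real.log x ^ j) := by
      have hW1 : (1 : ℝ) ≤ W := by exact_mod_cast hW
      have : (G 1 - G W) / (j + 1) ≤ (W - 1) * Real.log x ^ j := by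
        rw [div_le_iff₀ (by positivity)]
        linarith
      have h4 : (W.totient : ℝ) / W ≤ 1 := by rwa [div_le_one hWr]
      have h5 : 0 ≤ (W - 1) * Real.log x ^ j := mul_nonneg (by linarith) hp
      calc _ ≤ W.totient / W * ((W - 1) * Real.log x ^ j) := by gcongr
        _ ≤ _ := by gcongr
    linarith
  · have h1 := hhi.trans (mul_le_mul_of_nonneg_left hupp (by positivity))
    have h2 : (W.totient : ℝ) * (Real.log x ^ j + G 1 / ((j + 1) * W)) =
        W.totient * Real.log x ^ j + (W.totient : ℝ) / W * (G 1 / (j + 1)) := by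
      field_simp
    have h3 : (W.totient : ℝ) * Real.log x ^ j ≤ W * Real.log x ^ j := by gcongr
    linarith

/-- `∑_{n ≤ x} (1/n) (log (x/n))^l ≥ (log x)^(l+1) / (l+1)`. -/
lemma truncLog_le_sum (l : ℕ) {x : ℝ} (hx : 0 < x) :
    truncLog (l + 1) x / (l + 1) ≤ ∑ n ∈ Icc 1 ⌊x⌋₊, (1 / (n : ℝ)) * truncLog l (x / n) := by
  have hstep : ∀ n : ℕ, 1 ≤ n → truncLog (l + 1) (x / n) - truncLog (l + 1) (x / (n + 1 : ℕ)) ≤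
      (l + 1) * ((1 / (n : ℝ)) * truncLog l (x / n)) := by
    intro n hn
    have hn' : (0 : ℝ) < n := by exact_mod_cast hn
    have := truncLog_sub_le (s := n) (t := (n + 1 : ℕ)) hx hn' (by push_cast; linarith) l
    refine this.trans (le_of_eq ?_)
    push_cast
    ring
  rw [div_le_iff₀' (by positivity), mul_sum]
  calc truncLog (l + 1) x = truncLog (l + 1) (x / (1 : ℕ)) -
        truncLog (l + 1) (x / (⌊x⌋₊ + 1 : ℕ)) := by
        rw [truncLog_of_lt_one (x := x / (⌊x⌋₊ + 1 : ℕ))]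
        · simp
        · rw [div_lt_one (by positivity)]
          exact_mod_cast Nat.lt_floor_add_one x
    _ = ∑ n ∈ Ico 1 (⌊x⌋₊ + 1),
        (truncLog (l + 1) (x / n) - truncLog (l + 1) (x / (n + 1 : ℕ))) := by
        rw [sum_Ico_eq_sum_range]
        have := sum_range_sub' (fun i : ℕ => truncLog (l + 1) (x / (1 + i : ℕ))) ⌊x⌋₊
        simp only [add_zero] at this
        rw [Nat.add_sub_cancel, add_comm ⌊x⌋₊ 1, ← this]
        rfl
    _ ≤ ∑ n ∈ Ico 1 (⌊x⌋₊ + 1), (l + 1) * ((1 / (n : ℝ)) * truncLog l (x / n)) :=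
        sum_le_sum fun n hn => hstep n (mem_Ico.1 hn).1
    _ = _ := rfl

/-! ### Iterated sums over integers coprime to `W` -/

/-- The `m`-fold sum `∑ (log (x / (r₁ ⋯ rₘ))) ^ j / (r₁ ⋯ rₘ)` over integers `rᵢ` coprime to `W`
with `r₁ ⋯ rₘ ≤ x`. -/
noncomputable def coprimeSum (W : ℕ) (j : ℕ) : ℕ → ℝ → ℝ
  | 0, x => truncLog j x
  | m + 1, x => ∑ r ∈ Icc 1 ⌊x⌋₊ with W.Coprime r, (1 / (r : ℝ)) * coprimeSum W j m (x / r)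

lemma coprimeSum_nonneg (W j m : ℕ) (x : ℝ) : 0 ≤ coprimeSum W j m x := by
  induction m generalizing x with
  | zero => exact truncLog_nonneg j x
  | succ m ih => exact sum_nonneg fun r _ => mul_nonneg (by positivity) (ih _)

lemma coprimeSum_of_lt_one (W j m : ℕ) {x : ℝ} (hx : x < 1) : coprimeSum W j m x = 0 := by
  cases m with
  | zero => exact truncLog_of_lt_one hx
  | succ m =>
    have : ⌊x⌋₊ = 0 := Nat.floor_eq_zero.2 hx
    simp [coprimeSum, this]

lemma one_le_div_of_mem_Icc_floor {x : ℝ} {r : ℕ} (hr : r ∈ Icc 1 ⌊x⌋₊) : 1 ≤ x / r := by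
  rw [mem_Icc] at hr
  have h0 : (0 : ℝ) < r := by exact_mod_cast hr.1
  rw [one_le_div h0]
  exact (Nat.le_floor_iff' (by omega)).1 hr.2

lemma log_div_le_of_mem_Icc_floor {x : ℝ} {r : ℕ} (hx : 1 ≤ x) (hr : r ∈ Icc 1 ⌊x⌋₊) :
    Real.log (x / r) ≤ Real.log x := by
  have h1 := one_le_div_of_mem_Icc_floor hr
  refine Real.log_le_log (by linarith) (div_le_self (by linarith) ?_)
  exact_mod_cast (mem_Icc.1 hr).1

lemma sum_coprime_inv_le (W : ℕ) {x : ℝ} (hx : 1 ≤ x) :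
    ∑ r ∈ Icc 1 ⌊x⌋₊ with W.Coprime r, (1 / (r : ℝ)) ≤ 1 + Real.log x := by
  refine le_trans ?_ (harmonic_floor_le_one_add_log x hx)
  rw [harmonic_eq_sum_Icc]
  push_cast
  simp_rw [one_div]
  exact sum_le_sum_of_subset_of_nonneg (filter_subset _ _) fun _ _ _ => by positivity

lemma coprimeSum_zero_le (W m : ℕ) {x : ℝ} (hx : 1 ≤ x) :
    coprimeSum W 0 m x ≤ (1 + Real.log x) ^ m := by
  induction m generalizing x with
  | zero => simp [coprimeSum, truncLog_of_one_le hx]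
  | succ m ih =>
    have hL := Real.log_nonneg hx
    rw [coprimeSum, pow_succ']
    calc _ ≤ ∑ r ∈ Icc 1 ⌊x⌋₊ with W.Coprime r, (1 / (r : ℝ)) * (1 + Real.log x) ^ m := by
          refine sum_le_sum fun r hr => ?_
          have hr' := (mem_filter.1 hr).1
          have h1 := one_le_div_of_mem_Icc_floor hr'
          have h2 := Real.log_nonneg h1
          have h3 := log_div_le_of_mem_Icc_floor hx hr'
          refine mul_le_mul_of_nonneg_left ((ih h1).trans ?_) (by positivity)
          gcongr
      _ ≤ _ := by
          rw [← sum_mul]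
          gcongr
          exact sum_coprime_inv_le W hx

/-- Each further summation multiplies by `φ(W)/W` and integrates a power of the logarithm, dividing
by its new exponent; hence the factorial quotient. The error constant may depend on `W`, which is
fixed before `N` grows. -/
lemma coprimeSum_asymptotic {W : ℕ} (hW : 0 < W) (j m : ℕ) :
    ∃ C : ℝ, 0 ≤ C ∧ ∀ x : ℝ, 1 ≤ x →
      |coprimeSum W j (m + 1) x - ((W.totient : ℝ) / W) ^ (m + 1) *
        (j.factorial / (j + m + 1).factorial) * Real.log x ^ (j + m + 1)|
        ≤ C * (1 + Real.log x) ^ (j + m) := by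
  induction m with
  | zero =>
    refine ⟨W, by positivity, fun x hx => ?_⟩
    have hL := Real.log_nonneg hx
    have h := sum_coprime_truncLog hW j hx
    simp only [zero_add, add_zero, pow_one]
    have h1 : (W.totient : ℝ) / W * (j.factorial / (j + 1).factorial) * Real.log x ^ (j + 1) =
        W.totient / W * (Real.log x ^ (j + 1) / (j + 1)) := by
      rw [Nat.factorial_succ]
      push_cast
      have : (j.factorial : ℝ) ≠ 0 := by positivity
      field_simp
    rw [h1]
    refine h.trans ?_
    gcongr
    linarith
  | succ m ih =>
    obtain ⟨C, hC, hb⟩ := ih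
    set c : ℝ := (W.totient : ℝ) / W with hc
    set J := j + m + 1 with hJ
    set A : ℝ := c ^ (m + 1) * (j.factorial / J.factorial) with hA
    have hA0 : 0 ≤ A := by positivity
    refine ⟨A * W + C, by positivity, fun x hx => ?_⟩
    have hL := Real.log_nonneg hx
    have hmain := sum_coprime_truncLog hW J hx
    have hcoef : c ^ (m + 1 + 1) * (j.factorial / (j + (m + 1) + 1).factorial) *
        Real.log x ^ (j + (m + 1) + 1) = A * (c * (Real.log x ^ (J + 1) / (J + 1))) := by
      have e : j + (m + 1) + 1 = J + 1 := by omega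
      rw [e, Nat.factorial_succ, hA]
      push_cast
      have : (J.factorial : ℝ) ≠ 0 := by positivity
      field_simp
      ring
    have herr : |coprimeSum W j (m + 1 + 1) x -
        A * ∑ r ∈ Icc 1 ⌊x⌋₊ with W.Coprime r, (1 / (r : ℝ)) * truncLog J (x / r)| ≤
        C * (1 + Real.log x) ^ (j + m) * (1 + Real.log x) := by
      rw [coprimeSum, mul_sum, ← sum_sub_distrib]
      refine (abs_sum_le_sum_abs _ _).trans ?_
      calc _ ≤ ∑ r ∈ Icc 1 ⌊x⌋₊ with W.Coprime r,
            (C * (1 + Real.log x) ^ (j + m)) * (1 / (r : ℝ)) := by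
            refine sum_le_sum fun r hr => ?_
            have hr' := (mem_filter.1 hr).1
            have h1 := one_le_div_of_mem_Icc_floor hr'
            have h2 := Real.log_nonneg h1
            have h3 := log_div_le_of_mem_Icc_floor hx hr'
            have h4 := hb (x / r) h1
            rw [truncLog_of_one_le h1]
            have e : (1 / (r : ℝ)) * coprimeSum W j (m + 1) (x / r) -
                A * ((1 / (r : ℝ)) * Real.log (x / r) ^ J) =
                (1 / (r : ℝ)) * (coprimeSum W j (m + 1) (x / r) - A * Real.log (x / r) ^ J) := by
              ring
            rw [e, abs_mul, abs_of_nonneg (by positivity), mul_comm]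
            refine mul_le_mul_of_nonneg_right (h4.trans ?_) (by positivity)
            gcongr
        _ ≤ _ := by
            rw [← mul_sum]
            have := sum_coprime_inv_le W hx
            gcongr
    rw [hcoef]
    have hm2 : |A * ∑ r ∈ Icc 1 ⌊x⌋₊ with W.Coprime r, (1 / (r : ℝ)) * truncLog J (x / r) -
        A * (c * (Real.log x ^ (J + 1) / (J + 1)))| ≤ A * (W * (1 + Real.log x) ^ J) := by
      rw [← mul_sub, abs_mul, abs_of_nonneg hA0]
      refine mul_le_mul_of_nonneg_left (hmain.trans ?_) hA0
      gcongr
      linarith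
    refine (abs_sub_le _ _ _).trans ((add_le_add herr hm2).trans (le_of_eq ?_))
    rw [show j + (m + 1) = J by omega, hJ]
    ring

/-! ### From integers to sets of primes -/

lemma sum_inv_le_prod_of_primeFactors_subset {P S : Finset ℕ} (hP : ∀ p ∈ P, p.Prime)
    (hS : ∀ n ∈ S, n ≠ 0 ∧ n.primeFactors ⊆ P) :
    ∑ n ∈ S, (1 / (n : ℝ)) ≤ ∏ p ∈ P, ((p : ℝ) / (p - 1)) := by
  obtain ⟨f, hfn⟩ : ∃ f : ℕ →* ℝ, ∀ n, f n = (n : ℝ)⁻¹ :=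
    ⟨{ toFun := fun n => (n : ℝ)⁻¹
       map_one' := by simp
       map_mul' := fun m n => by push_cast; rw [mul_inv] }, fun n => rfl⟩
  have hf : ∀ {p : ℕ}, p.Prime → ‖f p‖ < 1 := by
    intro p hp
    have : (1 : ℝ) < p := by exact_mod_cast hp.one_lt
    rw [hfn, norm_inv, Real.norm_of_nonneg (by linarith)]
    exact inv_lt_one_of_one_lt₀ this
  have h := (EulerProduct.summable_and_hasSum_factoredNumbers_prod_filter_prime_geometric hf P).2
  have hfil : P.filter Nat.Prime = P := filter_true_of_mem hP
  rw [hfil] at h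
  have h' := (hasSum_subtype_iff_indicator (f := fun n => f n)).1 h
  have hle := sum_le_hasSum S (fun n _ => Set.indicator_nonneg
    (fun n _ => by rw [hfn]; positivity) n) h'
  refine le_trans (sum_le_sum fun n hn => ?_) (hle.trans (le_of_eq (prod_congr rfl fun p hp => ?_)))
  · rw [Set.indicator_of_mem (Nat.mem_factoredNumbers_iff_primeFactors_subset.2 (hS n hn)), one_div,
      hfn]
  · rw [hfn]
    have : (1 : ℝ) < p := by exact_mod_cast (hP p hp).one_lt
    have h1 : (p : ℝ) - 1 ≠ 0 := by linarith
    field_simp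

lemma prod_dvd_of_subset_primeFactors {u : Finset ℕ} {r : ℕ} (hu : u ⊆ r.primeFactors) :
    ∏ p ∈ u, p ∣ r :=
  (prod_dvd_prod_of_subset _ _ _ hu).trans (Nat.prod_primeFactors_dvd r)

/-- Grouping integers by the set of their prime factors outside `Q`. -/
lemma sum_inv_mul_primeFactors_le {P Q S : Finset ℕ} (hP : ∀ p ∈ P, p.Prime)
    (hQ : ∀ p ∈ Q, p.Prime) (hPQ : Disjoint P Q)
    (hS : ∀ n ∈ S, n ≠ 0 ∧ n.primeFactors ⊆ P ∪ Q) (F : Finset ℕ → ℝ) (hF : ∀ u, 0 ≤ F u) :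
    ∑ n ∈ S, (1 / (n : ℝ)) * F (n.primeFactors \ Q) ≤
      (∏ p ∈ Q, ((p : ℝ) / (p - 1))) *
        ∑ u ∈ P.powerset, (∏ p ∈ u, (1 / ((p : ℝ) - 1))) * F u := by
  have hmaps : ∀ n ∈ S, n.primeFactors \ Q ∈ P.powerset := by
    intro n hn
    rw [mem_powerset]
    intro p hp
    rw [mem_sdiff] at hp
    exact (mem_union.1 ((hS n hn).2 hp.1)).resolve_right hp.2
  rw [← sum_fiberwise_of_maps_to hmaps, mul_sum]
  refine sum_le_sum fun u hu => ?_
  rw [mem_powerset] at hu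
  have hpos : ∀ p ∈ u, (0 : ℝ) < p := fun p hp => by exact_mod_cast (hP p (hu hp)).pos
  have hprod : (0 : ℝ) < ∏ p ∈ u, (p : ℝ) := prod_pos hpos
  have e1 : ∑ n ∈ S with n.primeFactors \ Q = u, (1 / (n : ℝ)) * F (n.primeFactors \ Q) =
      (∑ n ∈ S with n.primeFactors \ Q = u, (1 / (n : ℝ))) * F u := by
    rw [sum_mul]
    refine sum_congr rfl fun n hn => ?_
    rw [(mem_filter.1 hn).2]
  rw [e1, ← mul_assoc]
  refine mul_le_mul_of_nonneg_right ?_ (hF u)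
  have hdvd : ∀ n ∈ S.filter (fun n => n.primeFactors \ Q = u), (∏ p ∈ u, p) ∣ n := by
    intro n hn
    rw [mem_filter] at hn
    refine prod_dvd_of_subset_primeFactors ?_
    rw [← hn.2]
    exact sdiff_subset
  have e2 : ∑ n ∈ S with n.primeFactors \ Q = u, (1 / (n : ℝ)) =
      (1 / ∏ p ∈ u, (p : ℝ)) *
      ∑ m ∈ (S.filter fun n => n.primeFactors \ Q = u).image (fun n => n / ∏ p ∈ u, p),
        (1 / (m : ℝ)) := by
    rw [sum_image, mul_sum]
    · refine sum_congr rfl fun n hn => ?_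
      rw [Nat.cast_div (hdvd n hn) (by push_cast; exact hprod.ne')]
      push_cast
      field_simp
    · intro a ha b hb hab
      have h1 := Nat.div_mul_cancel (hdvd a ha)
      have h2 := Nat.div_mul_cancel (hdvd b hb)
      simp only at hab
      rw [← h1, ← h2, hab]
  -- Each `n` in the fibre is `∏ u` times a cofactor with primes in `u ∪ Q`. The Euler product over
  -- the cofactors turns each `1/p`, `p ∈ u`, into `1/(p-1)` and leaves `p/(p-1)` for `p ∈ Q`.
  have hle := sum_inv_le_prod_of_primeFactors_subset (P := u ∪ Q)
    (S := (S.filter fun n => n.primeFactors \ Q = u).image (fun n => n / ∏ p ∈ u, p))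
    (fun p hp => (mem_union.1 hp).elim (fun h => hP p (hu h)) (hQ p)) (by
      intro m hm
      obtain ⟨n, hn, rfl⟩ := mem_image.1 hm
      have hd := hdvd n hn
      rw [mem_filter] at hn
      have hn0 := (hS n hn.1).1
      refine ⟨(Nat.div_pos (Nat.le_of_dvd (Nat.pos_of_ne_zero hn0) hd)
        (Nat.pos_of_dvd_of_pos hd (Nat.pos_of_ne_zero hn0))).ne', ?_⟩
      refine (Nat.primeFactors_mono (Nat.div_dvd_of_dvd hd) hn0).trans ?_
      rw [← hn.2]
      intro p hp
      by_cases hq : p ∈ Q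
      · exact mem_union_right _ hq
      · exact mem_union_left _ (mem_sdiff.2 ⟨hp, hq⟩))
  rw [e2]
  rw [prod_union (disjoint_of_subset_left hu hPQ)] at hle
  refine (mul_le_mul_of_nonneg_left hle (by positivity)).trans (le_of_eq ?_)
  rw [← mul_assoc, mul_comm]
  congr 1
  rw [one_div, ← prod_inv_distrib, ← prod_mul_distrib]
  refine prod_congr rfl fun p hp => ?_
  have := hpos p hp
  field_simp

section Lattice

variable {α : Type*} [DecidableEq α]

/-- Each element of `w = u ∪ v` lies in `u` only, in `v` only, or in both, which accounts for the
three terms of the local factor. -/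
lemma sum_powerset_sum_powerset_union (P : Finset α) (a b : α → ℝ) (G : Finset α → ℝ) :
    ∑ u ∈ P.powerset, ∑ v ∈ P.powerset, (∏ p ∈ u, a p) * (∏ p ∈ v, b p) * G (u ∪ v) =
      ∑ w ∈ P.powerset, (∏ p ∈ w, (a p + b p + a p * b p)) * G w := by
  induction P using Finset.induction_on generalizing G with
  | empty => simp
  | insert x P hx ih =>
    have hnot : ∀ u ∈ P.powerset, x ∉ u := fun u hu h => hx (mem_powerset.1 hu h)
    simp only [sum_powerset_insert hx, sum_add_distrib]
    have h1 := ih G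
    have h2 := ih (fun w => G (insert x w))
    have e1 : ∑ u ∈ P.powerset, ∑ v ∈ P.powerset,
        (∏ p ∈ u, a p) * (∏ p ∈ insert x v, b p) * G (u ∪ insert x v) =
        b x * ∑ u ∈ P.powerset, ∑ v ∈ P.powerset,
          (∏ p ∈ u, a p) * (∏ p ∈ v, b p) * G (insert x (u ∪ v)) := by
      simp only [mul_sum]
      refine sum_congr rfl fun u hu => sum_congr rfl fun v hv => ?_
      rw [prod_insert (hnot v hv), union_insert]
      ring
    have e2 : ∑ u ∈ P.powerset, ∑ v ∈ P.powerset,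
        (∏ p ∈ insert x u, a p) * (∏ p ∈ v, b p) * G (insert x u ∪ v) =
        a x * ∑ u ∈ P.powerset, ∑ v ∈ P.powerset,
          (∏ p ∈ u, a p) * (∏ p ∈ v, b p) * G (insert x (u ∪ v)) := by
      simp only [mul_sum]
      refine sum_congr rfl fun u hu => sum_congr rfl fun v hv => ?_
      rw [prod_insert (hnot u hu), insert_union]
      ring
    have e3 : ∑ u ∈ P.powerset, ∑ v ∈ P.powerset,
        (∏ p ∈ insert x u, a p) * (∏ p ∈ insert x v, b p) * G (insert x u ∪ insert x v) =
        a x * b x * ∑ u ∈ P.powerset, ∑ v ∈ P.powerset,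
          (∏ p ∈ u, a p) * (∏ p ∈ v, b p) * G (insert x (u ∪ v)) := by
      simp only [mul_sum]
      refine sum_congr rfl fun u hu => sum_congr rfl fun v hv => ?_
      rw [prod_insert (hnot u hu), prod_insert (hnot v hv), insert_union, union_insert,
        insert_idem]
      ring
    have e4 : ∑ w ∈ P.powerset, (∏ p ∈ insert x w, (a p + b p + a p * b p)) * G (insert x w) =
        (a x + b x + a x * b x) *
          ∑ w ∈ P.powerset, (∏ p ∈ w, (a p + b p + a p * b p)) * G (insert x w) := by
      rw [mul_sum]
      refine sum_congr rfl fun u hu => ?_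
      rw [prod_insert (hnot u hu)]
      ring
    rw [e1, e2, e3, e4, ← h1, ← h2]
    ring

/-- Expanding the product splits `w` into disjoint `u` and `v`. The remaining pairs on the right
contribute nonnegative terms. -/
lemma sum_powerset_prod_add_le (P : Finset α) (a b : α → ℝ) (ha : ∀ p ∈ P, 0 ≤ a p)
    (hb : ∀ p ∈ P, 0 ≤ b p) (G : Finset α → ℝ) (H : Finset α → Finset α → ℝ)
    (hH : ∀ u v, 0 ≤ H u v) (hGH : ∀ u v, Disjoint u v → G (u ∪ v) ≤ H u v) :
    ∑ w ∈ P.powerset, (∏ p ∈ w, (a p + b p)) * G w ≤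
      ∑ u ∈ P.powerset, ∑ v ∈ P.powerset, (∏ p ∈ u, a p) * (∏ p ∈ v, b p) * H u v := by
  have key : ∀ w ∈ P.powerset, (∏ p ∈ w, (a p + b p)) * G w ≤
      ∑ u ∈ P.powerset, ∑ v ∈ P.powerset,
        if Disjoint u v ∧ u ∪ v = w then (∏ p ∈ u, a p) * (∏ p ∈ v, b p) * H u v else 0 := by
    intro w hw
    rw [mem_powerset] at hw
    rw [prod_add, sum_mul]
    refine le_trans ?_ (sum_le_sum_of_subset_of_nonneg (powerset_mono.2 hw) fun u hu _ =>
      sum_nonneg fun v hv => ?_)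
    · refine sum_le_sum fun u hu => ?_
      rw [mem_powerset] at hu
      have hd : Disjoint u (w \ u) ∧ u ∪ w \ u = w := ⟨disjoint_sdiff, union_sdiff_of_subset hu⟩
      refine le_trans ?_ (single_le_sum (f := fun v => if Disjoint u v ∧ u ∪ v = w then
        (∏ p ∈ u, a p) * (∏ p ∈ v, b p) * H u v else 0) (fun v hv => ?_)
        (mem_powerset.2 (sdiff_subset.trans hw) : w \ u ∈ P.powerset))
      · simp only [hd, and_self, if_true]
        have := hGH u (w \ u) hd.1
        rw [hd.2] at this
        refine mul_le_mul_of_nonneg_left this (mul_nonneg ?_ ?_)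
        · exact prod_nonneg fun p hp => ha p (hw (hu hp))
        · exact prod_nonneg fun p hp => hb p (hw (sdiff_subset hp))
      · rw [mem_powerset] at hv
        split_ifs
        · exact mul_nonneg (mul_nonneg (prod_nonneg fun p hp => ha p (hw (hu hp)))
            (prod_nonneg fun p hp => hb p (hv hp))) (hH _ _)
        · exact le_rfl
    · rw [mem_powerset] at hu hv
      split_ifs
      · exact mul_nonneg (mul_nonneg (prod_nonneg fun p hp => ha p (hu hp))
            (prod_nonneg fun p hp => hb p (hv hp))) (hH _ _)
      · exact le_rfl
  refine (sum_le_sum key).trans ?_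
  rw [sum_comm]
  refine sum_le_sum fun u hu => ?_
  rw [sum_comm]
  refine sum_le_sum fun v hv => ?_
  rw [mem_powerset] at hu hv
  have h0 : 0 ≤ (∏ p ∈ u, a p) * (∏ p ∈ v, b p) * H u v :=
    mul_nonneg (mul_nonneg (prod_nonneg fun p hp => ha p (hu hp))
            (prod_nonneg fun p hp => hb p (hv hp))) (hH _ _)
  by_cases hd : Disjoint u v
  · simp only [hd, true_and]
    rw [sum_ite_eq]
    split_ifs
    · exact le_rfl
    · exact h0
  · simp [hd, h0]

end Lattice

/-! ### Sums over sets of primes compared with `coprimeSum` -/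

lemma prod_union_le_mul {u v : Finset ℕ} (hu : ∀ p ∈ u, 0 < p) :
    ∏ p ∈ u ∪ v, p ≤ (∏ p ∈ u, p) * ∏ p ∈ v, p := by
  rw [← prod_union_inter]
  exact Nat.le_mul_of_pos_right _ (prod_pos fun p hp => hu p (mem_inter.1 hp).1)

/-- The lower bound for a sifted sum in terms of `coprimeSum`. -/
lemma coprimeSum_le_sum_powerset (W j m : ℕ) {P : Finset ℕ} (hP : ∀ p ∈ P, p.Prime ∧ m < p)
    (x : ℝ) (hx : ∀ p : ℕ, p.Prime → (p : ℝ) ≤ x → ¬ p ∣ W → p ∈ P) :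
    coprimeSum W j m x ≤ ∑ v ∈ P.powerset, (∏ p ∈ v, ((m : ℝ) / (p - m))) *
      truncLog j (x / ∏ p ∈ v, (p : ℝ)) := by
  induction m generalizing x with
  | zero =>
    refine le_trans ?_ (single_le_sum (f := fun v : Finset ℕ => (∏ p ∈ v, (((0 : ℕ) : ℝ) / ((p : ℝ) - (0 : ℕ)))) *
      truncLog j (x / ∏ p ∈ v, (p : ℝ))) (fun v _ => ?_) (empty_mem_powerset P))
    · simp [coprimeSum]
    · exact mul_nonneg (prod_nonneg fun p _ => by simp) (truncLog_nonneg _ _)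
  | succ m ih =>
    have hb0 : ∀ v ∈ P.powerset, 0 ≤ ∏ p ∈ v, ((m : ℝ) / (p - m)) := by
      intro v hv
      refine prod_nonneg fun p hp => ?_
      have : m + 1 < p := (hP p (mem_powerset.1 hv hp)).2
      have : (m : ℝ) + 1 < p := by exact_mod_cast this
      exact div_nonneg (by positivity) (by linarith)
    set F : Finset ℕ → ℝ := fun u => ∑ v ∈ P.powerset, (∏ p ∈ v, ((m : ℝ) / (p - m))) *
      truncLog j (x / (∏ p ∈ u ∪ v, p : ℕ)) with hF
    have hstep : coprimeSum W j (m + 1) x ≤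
        ∑ r ∈ Icc 1 ⌊x⌋₊ with W.Coprime r, (1 / (r : ℝ)) * F (r.primeFactors \ ∅) := by
      rw [coprimeSum]
      refine sum_le_sum fun r hr => ?_
      rw [mem_filter] at hr
      have hr1 := (mem_Icc.1 hr.1).1
      have hr0 : (0 : ℝ) < r := by exact_mod_cast hr1
      refine mul_le_mul_of_nonneg_left ?_ (by positivity)
      have hx1 := one_le_div_of_mem_Icc_floor hr.1
      have hxr : x / r ≤ x := by
        have : 0 < x := by
          by_contra h
          have : x / r ≤ 0 := div_nonpos_of_nonpos_of_nonneg (not_lt.1 h) hr0.le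
          linarith
        exact div_le_self this.le (by exact_mod_cast hr1)
      refine (ih (fun p hp => ⟨(hP p hp).1, (Nat.lt_succ_self m).trans (hP p hp).2⟩) (x / r)
        (fun p hp hpx => hx p hp (hpx.trans hxr))).trans ?_
      refine sum_le_sum fun v hv => mul_le_mul_of_nonneg_left ?_ (hb0 v hv)
      refine truncLog_mono j ?_
      rw [div_div]
      have hvpos : ∀ p ∈ v, 0 < p := fun p hp => (hP p (mem_powerset.1 hv hp)).1.pos
      have hupos : ∀ p ∈ r.primeFactors, 0 < p := fun p hp => (Nat.prime_of_mem_primeFactors hp).pos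
      have h1 : ∏ p ∈ r.primeFactors \ ∅ ∪ v, p ≤ r * ∏ p ∈ v, p := by
        rw [sdiff_empty]
        refine (prod_union_le_mul hupos).trans (Nat.mul_le_mul_right _ ?_)
        exact Nat.le_of_dvd hr1 (Nat.prod_primeFactors_dvd r)
      have h1' : ((∏ p ∈ r.primeFactors \ ∅ ∪ v, p : ℕ) : ℝ) ≤ r * ∏ p ∈ v, (p : ℝ) := by
        have := (Nat.cast_le (α := ℝ)).2 h1
        push_cast at this ⊢
        exact this
      have h2 : 0 < ((∏ p ∈ r.primeFactors \ ∅ ∪ v, p : ℕ) : ℝ) := by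
        rw [sdiff_empty]
        exact_mod_cast prod_pos fun p hp => (mem_union.1 hp).elim (hupos p) (hvpos p)
      have hx0 : 0 ≤ x := by linarith
      gcongr
    -- Grouping `r` by its set of prime factors replaces `1/r` by `∏ 1/(p-1)`, a sum over sets that
    -- is then merged with the one over `v`.
    refine hstep.trans ((sum_inv_mul_primeFactors_le (P := P) (Q := ∅) (fun p hp => (hP p hp).1)
      (by simp) (disjoint_empty_right _) ?_ F ?_).trans ?_)
    · intro n hn
      rw [mem_filter, mem_Icc] at hn
      refine ⟨by omega, fun p hp => ?_⟩
      rw [union_empty]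
      have hpp := Nat.prime_of_mem_primeFactors hp
      have hpn := Nat.dvd_of_mem_primeFactors hp
      refine hx p hpp ?_ fun hpW => ?_
      · have h1 : p ≤ ⌊x⌋₊ := (Nat.le_of_dvd (by omega) hpn).trans hn.1.2
        exact (Nat.le_floor_iff' hpp.ne_zero).1 h1
      · exact hpp.one_lt.ne' (Nat.dvd_one.1 (hn.2 ▸ Nat.dvd_gcd hpW hpn))
    · intro u
      exact sum_nonneg fun v hv => mul_nonneg (hb0 v hv) (truncLog_nonneg _ _)
    · rw [prod_empty, one_mul]
      have e := sum_powerset_sum_powerset_union P (fun p : ℕ => 1 / ((p : ℝ) - 1))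
        (fun p : ℕ => (m : ℝ) / (p - m)) (fun w => truncLog j (x / (∏ p ∈ w, p : ℕ)))
      simp only [hF, mul_sum]
      simp only [mul_assoc] at e ⊢
      rw [e]
      refine sum_le_sum fun w hw => ?_
      push_cast
      refine mul_le_mul_of_nonneg_right (prod_le_prod (fun p hp => ?_) fun p hp => ?_)
        (truncLog_nonneg _ _)
      all_goals
        have h1 : m + 1 < p := (hP p (mem_powerset.1 hw hp)).2
        have h2 : (m : ℝ) + 1 < p := by exact_mod_cast h1
        have h3 : (0 : ℝ) ≤ m := by positivity
        have h4 : (0 : ℝ) < p - m := by linarith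
        have h5 : (0 : ℝ) < p - 1 := by linarith
      · positivity
      -- After adding 1, the claim is `p/(p-1) · p/(p-m) ≤ p/(p-m-1)`, that is, `p(p-m-1) ≤
      -- (p-1)(p-m)`; the two sides of the latter differ by `m`.
      · have h6 : (0 : ℝ) < p - (m + 1) := by linarith
        rw [div_add_div _ _ h5.ne' h4.ne', div_mul_div_comm, ← add_div,
          div_le_div_iff₀ (by positivity) h6]
        nlinarith [mul_nonneg h3 h3, mul_pos h4 h5, mul_nonneg h3 h4.le]

lemma prod_primes_injOn {P : Finset ℕ} (hP : ∀ p ∈ P, p.Prime) :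
    Set.InjOn (fun u : Finset ℕ => ∏ p ∈ u, p) P.powerset := by
  intro u hu v hv huv
  rw [mem_coe, mem_powerset] at hu hv
  have h1 := Nat.primeFactors_prod (s := u) fun p hp => hP p (hu hp)
  have h2 := Nat.primeFactors_prod (s := v) fun p hp => hP p (hv hp)
  simp only at huv
  rw [← h1, ← h2, huv]

/-- The upper bound for a squarefree sum in terms of `coprimeSum`. -/
lemma sum_powerset_le_coprimeSum (W j m : ℕ) {P : Finset ℕ} (hP : ∀ p ∈ P, p.Prime ∧ ¬ p ∣ W)
    (x : ℝ) :
    ∑ v ∈ P.powerset, (∏ p ∈ v, ((m : ℝ) / p)) * truncLog j (x / ∏ p ∈ v, (p : ℝ)) ≤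
      coprimeSum W j m x := by
  induction m generalizing x with
  | zero =>
    rw [sum_eq_single ∅]
    · simp [coprimeSum]
    · intro v _ hv
      obtain ⟨p, hp⟩ := nonempty_iff_ne_empty.2 hv
      rw [prod_eq_zero hp (by simp), zero_mul]
    · simp
  | succ m ih =>
    have h1 := sum_powerset_prod_add_le P (fun p : ℕ => 1 / (p : ℝ)) (fun p : ℕ => (m : ℝ) / p)
      (fun p _ => by positivity) (fun p _ => by positivity)
      (fun w => truncLog j (x / ∏ p ∈ w, (p : ℝ)))
      (fun u v => truncLog j (x / (∏ p ∈ u, (p : ℝ)) / ∏ p ∈ v, (p : ℝ)))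
      (fun u v => truncLog_nonneg _ _) (fun u v huv => by rw [prod_union huv, div_div])
    have e : ∀ p : ℕ, ((m + 1 : ℕ) : ℝ) / p = 1 / (p : ℝ) + m / p := fun p => by
      push_cast
      ring
    simp only [e]
    refine h1.trans ?_
    calc _ ≤ ∑ u ∈ P.powerset, (1 / ((∏ p ∈ u, p : ℕ) : ℝ)) *
          coprimeSum W j m (x / (∏ p ∈ u, p : ℕ)) := by
          refine sum_le_sum fun u _ => ?_
          simp only [mul_assoc]
          rw [← mul_sum]
          push_cast
          rw [prod_div_distrib, prod_const_one]
          refine mul_le_mul_of_nonneg_left (ih _) ?_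
          positivity
      -- Distinct sets of primes have distinct products, so the first set can be read as a
      -- squarefree integer, one of the values of `r` in `coprimeSum`.
      _ = ∑ n ∈ P.powerset.image (fun u => ∏ p ∈ u, p), (1 / (n : ℝ)) *
          coprimeSum W j m (x / n) := by
          rw [sum_image (prod_primes_injOn fun p hp => (hP p hp).1)]
      _ ≤ coprimeSum W j (m + 1) x := by
          rw [coprimeSum, ← sum_subset (filter_subset (fun n : ℕ => (n : ℝ) ≤ x) _)]
          · refine sum_le_sum_of_subset_of_nonneg (fun n hn => ?_) fun n _ _ =>
              mul_nonneg (by positivity) (coprimeSum_nonneg _ _ _ _)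
            rw [mem_filter, mem_image] at hn
            obtain ⟨⟨u, hu, rfl⟩, hux⟩ := hn
            rw [mem_powerset] at hu
            have hpos : 0 < ∏ p ∈ u, p := prod_pos fun p hp => (hP p (hu hp)).1.pos
            rw [mem_filter, mem_Icc]
            refine ⟨⟨hpos, Nat.le_floor hux⟩, Nat.Coprime.prod_right fun p hp => ?_⟩
            exact (((hP p (hu hp)).1.coprime_iff_not_dvd).2 (hP p (hu hp)).2).symm
          · intro n hn hn'
            rw [mem_filter, not_and] at hn'
            obtain ⟨u, hu, rfl⟩ := mem_image.1 hn
            rw [mem_powerset] at hu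
            have hpos : 0 < ∏ p ∈ u, p := prod_pos fun p hp => (hP p (hu hp)).1.pos
            rw [coprimeSum_of_lt_one, mul_zero]
            rw [div_lt_one (by exact_mod_cast hpos)]
            exact not_le.1 (hn' hn)

/-- Split `k/(p-k) = k/p + k²/(p(p-k))`. Dropping the primes that take the second term from the
argument of `truncLog` only increases it, and these primes then sum to a separate product. -/
lemma sum_powerset_shifted_le_coprimeSum (W j k : ℕ) {P : Finset ℕ}
    (hP : ∀ p ∈ P, p.Prime ∧ ¬ p ∣ W ∧ k < p) (x : ℝ) (hx : 0 ≤ x) :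
    ∑ v ∈ P.powerset, (∏ p ∈ v, ((k : ℝ) / (p - k))) * truncLog j (x / ∏ p ∈ v, (p : ℝ)) ≤
      (∏ p ∈ P, (1 + (k : ℝ) ^ 2 / (p * (p - k)))) * coprimeSum W j k x := by
  have hkp : ∀ p ∈ P, (0 : ℝ) < p - k := fun p hp => by
    have : (k : ℝ) < p := by exact_mod_cast (hP p hp).2.2
    linarith
  have hp1 : ∀ p ∈ P, (1 : ℝ) ≤ p := fun p hp => by exact_mod_cast (hP p hp).1.one_lt.le
  have hnn : ∀ p ∈ P, 0 ≤ (k : ℝ) ^ 2 / (p * (p - k)) := fun p hp => by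
    have := hkp p hp
    positivity
  set H : Finset ℕ → Finset ℕ → ℝ := fun _ v => truncLog j (x / ∏ p ∈ v, (p : ℝ))
  have h1 := sum_powerset_prod_add_le P (fun p : ℕ => (k : ℝ) ^ 2 / (p * (p - k)))
    (fun p : ℕ => (k : ℝ) / p) hnn (fun p _ => by positivity)
    -- The guard is needed because the comparison is demanded for all sets, while lower bounds on
    -- the elements are known only within `P`.
    (fun w => if w ⊆ P then truncLog j (x / ∏ p ∈ w, (p : ℝ)) else 0) H
    (fun u v => truncLog_nonneg _ _) (fun u v huv => by
      split_ifs with h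
      · refine truncLog_mono j ?_
        have hu : (1 : ℝ) ≤ ∏ p ∈ u, (p : ℝ) := by
          refine one_le_prod fun p hp => hp1 p (h (mem_union_left _ hp))
        have hv : (0 : ℝ) < ∏ p ∈ v, (p : ℝ) :=
          prod_pos fun p hp => by linarith [hp1 p (h (mem_union_right _ hp))]
        rw [prod_union huv]
        refine div_le_div_of_nonneg_left hx hv ?_
        exact le_mul_of_one_le_left hv.le hu
      · exact truncLog_nonneg _ _)
  calc _ = ∑ w ∈ P.powerset, (∏ p ∈ w, ((k : ℝ) ^ 2 / (p * (p - k)) + (k : ℝ) / p)) *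
        (if w ⊆ P then truncLog j (x / ∏ p ∈ w, (p : ℝ)) else 0) := by
        refine sum_congr rfl fun w hw => ?_
        rw [mem_powerset] at hw
        rw [if_pos hw]
        congr 1
        refine prod_congr rfl fun p hp => ?_
        have h2 := hkp p (hw hp)
        have h3 := hp1 p (hw hp)
        have h4 : (p : ℝ) ≠ 0 := by linarith
        have h5 : (p : ℝ) - k ≠ 0 := h2.ne'
        field_simp
        ring
    _ ≤ _ := h1
    _ = (∑ u ∈ P.powerset, ∏ p ∈ u, ((k : ℝ) ^ 2 / (p * (p - k)))) *
        ∑ v ∈ P.powerset, (∏ p ∈ v, ((k : ℝ) / p)) * truncLog j (x / ∏ p ∈ v, (p : ℝ)) := by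
        rw [sum_mul_sum]
        simp only [H, mul_assoc]
    _ ≤ _ := by
        rw [prod_one_add]
        refine mul_le_mul_of_nonneg_left
          (sum_powerset_le_coprimeSum W j k (fun p hp => ⟨(hP p hp).1, (hP p hp).2.1⟩) x) ?_
        exact sum_nonneg fun u hu => prod_nonneg fun p hp => hnn p (mem_powerset.1 hu hp)

/-- Each term is at most `2k²/p²` because `k ≤ p/2`, and `∑_{n > D} 1/n² ≤ 1/D`. The bound tends to
1 as `D` grows, which is why small primes are put into `W`. -/
lemma prod_one_add_div_le_exp {k D : ℕ} (hD : 0 < D) (hkD : 2 * k ≤ D) {P : Finset ℕ}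
    (hP : ∀ p ∈ P, D < p) :
    ∏ p ∈ P, (1 + (k : ℝ) ^ 2 / (p * (p - k))) ≤ Real.exp (2 * k ^ 2 / D) := by
  have hkp : ∀ p ∈ P, (0 : ℝ) < p ∧ (k : ℝ) ≤ p / 2 := fun p hp => by
    have h1 : (D : ℝ) < p := by exact_mod_cast hP p hp
    have h2 : 2 * (k : ℝ) ≤ D := by exact_mod_cast hkD
    have h3 : (0 : ℝ) < D := by exact_mod_cast hD
    constructor <;> linarith
  have hexp : ∏ p ∈ P, (1 + (k : ℝ) ^ 2 / (p * (p - k))) ≤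
      Real.exp (∑ p ∈ P, (k : ℝ) ^ 2 / (p * (p - k))) := by
    rw [Real.exp_sum]
    refine prod_le_prod (fun p hp => ?_) fun p hp => by
      rw [add_comm]
      exact Real.add_one_le_exp _
    obtain ⟨h1, h2⟩ := hkp p hp
    have : (0 : ℝ) < p - k := by linarith
    positivity
  refine hexp.trans (Real.exp_le_exp.2 ?_)
  · calc ∑ p ∈ P, (k : ℝ) ^ 2 / (p * (p - k)) ≤ ∑ p ∈ P, 2 * (k : ℝ) ^ 2 * ((p : ℝ) ^ 2)⁻¹ := by
          refine sum_le_sum fun p hp => ?_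
          obtain ⟨h1, h2⟩ := hkp p hp
          have h3 : (0 : ℝ) < p - k := by linarith
          rw [← div_eq_mul_inv, div_le_div_iff₀ (by positivity) (by positivity)]
          nlinarith [mul_nonneg (sq_nonneg (k : ℝ)) (mul_nonneg h1.le (sub_nonneg.2 h2))]
      _ ≤ 2 * (k : ℝ) ^ 2 * ∑ p ∈ Ioc D (D + P.sup id), ((p : ℝ) ^ 2)⁻¹ := by
          rw [← mul_sum]
          refine mul_le_mul_of_nonneg_left ?_ (by positivity)
          refine sum_le_sum_of_subset_of_nonneg (fun p hp => ?_) fun _ _ _ => by positivity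
          have : p ≤ P.sup id := le_sup (f := id) hp
          rw [mem_Ioc]
          exact ⟨hP p hp, by omega⟩
      _ ≤ 2 * (k : ℝ) ^ 2 * (D : ℝ)⁻¹ := by
          refine mul_le_mul_of_nonneg_left ?_ (by positivity)
          have := sum_Ioc_inv_sq_le_sub (α := ℝ) hD.ne' (show D ≤ D + P.sup id by omega)
          refine this.trans (sub_le_self _ (by positivity))
      _ = _ := by ring

/-! ### Selberg diagonalisation over subsets -/

section Lattice

variable {α : Type*} [DecidableEq α]

lemma sum_filter_superset {P r : Finset α} (hr : r ⊆ P) (f : Finset α → ℝ) :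
    ∑ v ∈ P.powerset with r ⊆ v, f v = ∑ t ∈ (P \ r).powerset, f (r ∪ t) := by
  have e : P.powerset.filter (fun v => r ⊆ v) = Icc r P := by
    ext v
    simp only [mem_filter, mem_powerset, mem_Icc]
    tauto
  rw [e, Icc_eq_image_powerset hr, sum_image]
  intro a ha b hb hab
  rw [mem_coe, mem_powerset] at ha hb
  have h1 : ∀ c, c ⊆ P \ r → (r ∪ c) \ r = c := fun c hc =>
    union_sdiff_cancel_left (disjoint_of_subset_right hc disjoint_sdiff)
  simp only at hab
  rw [← h1 a ha, ← h1 b hb, hab]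

/-- The product over `s ∪ t` is the product over `s` times that over `t`, divided by that over `s ∩
t`; expanding the inverse over the subsets `r` of `s ∩ t` decouples `s` from `t`. -/
lemma prod_union_eq_sum {P s t : Finset α} (hs : s ⊆ P) (κ : α → ℝ)
    (hκ : ∀ p ∈ P, κ p ≠ 0) :
    ∏ p ∈ s ∪ t, κ p = ∑ r ∈ P.powerset,
      if r ⊆ s ∧ r ⊆ t then (∏ p ∈ r, ((κ p)⁻¹ - 1)) * ((∏ p ∈ s, κ p) * ∏ p ∈ t, κ p) else 0 := by
  rw [← sum_filter]
  have e : P.powerset.filter (fun r => r ⊆ s ∧ r ⊆ t) = (s ∩ t).powerset := by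
    ext r
    simp only [mem_filter, mem_powerset, subset_inter_iff]
    exact ⟨fun h => h.2, fun h => ⟨h.1.trans hs, h⟩⟩
  have h : (∏ p ∈ s ∩ t, κ p) * ∏ p ∈ s ∩ t, (κ p)⁻¹ = 1 := by
    rw [← prod_mul_distrib]
    exact prod_eq_one fun p hp => mul_inv_cancel₀ (hκ p (hs (mem_inter.1 hp).1))
  rw [e, ← sum_mul, ← prod_one_add, ← prod_union_inter]
  simp only [add_sub_cancel]
  linear_combination (-(∏ p ∈ s ∪ t, κ p)) * h

/-- Selberg's diagonalisation of the sieve quadratic form. -/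
lemma quadraticForm_eq_sum_sq (P : Finset α) (κ : α → ℝ) (hκ : ∀ p ∈ P, κ p ≠ 0)
    (w : Finset α → ℝ) :
    ∑ s ∈ P.powerset, ∑ t ∈ P.powerset, w s * w t * ∏ p ∈ s ∪ t, κ p =
      ∑ r ∈ P.powerset, (∏ p ∈ r, ((κ p)⁻¹ - 1)) *
        (∑ s ∈ P.powerset with r ⊆ s, w s * ∏ p ∈ s, κ p) ^ 2 := by
  have e1 : ∀ s ∈ P.powerset, ∀ t ∈ P.powerset, w s * w t * ∏ p ∈ s ∪ t, κ p =
      ∑ r ∈ P.powerset, (∏ p ∈ r, ((κ p)⁻¹ - 1)) *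
        ((if r ⊆ s then w s * ∏ p ∈ s, κ p else 0) *
          (if r ⊆ t then w t * ∏ p ∈ t, κ p else 0)) := by
    intro s hs t _
    rw [prod_union_eq_sum (mem_powerset.1 hs) κ hκ, mul_sum]
    refine sum_congr rfl fun r _ => ?_
    by_cases h1 : r ⊆ s <;> by_cases h2 : r ⊆ t <;> simp [h1, h2]
    ring
  rw [sum_congr rfl fun s hs => sum_congr rfl (e1 s hs)]
  rw [sum_congr rfl fun s _ => sum_comm, sum_comm]
  refine sum_congr rfl fun r _ => ?_
  rw [sum_filter, sq, sum_mul_sum, mul_sum]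
  simp_rw [mul_sum]

/-- The weights `w` attached to `z` by Möbius inversion on the lattice of subsets. -/
lemma sum_superset_mobius (P : Finset α) (β γ : α → ℝ) (z : Finset α → ℝ) {r : Finset α}
    (hr : r ⊆ P) :
    ∑ s ∈ P.powerset with r ⊆ s,
      ((∏ p ∈ s, β p) * ∑ v ∈ P.powerset with s ⊆ v, z v) * ∏ p ∈ s, γ p =
    (∏ p ∈ r, (β p * γ p)) *
      ∑ t ∈ (P \ r).powerset, z (r ∪ t) * ∏ p ∈ t, (1 + β p * γ p) := by
  have e1 : ∀ s : Finset α, ((∏ p ∈ s, β p) * ∑ v ∈ P.powerset with s ⊆ v, z v) * ∏ p ∈ s, γ p =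
      ∑ v ∈ P.powerset, if s ⊆ v then z v * ∏ p ∈ s, (β p * γ p) else 0 := by
    intro s
    rw [sum_filter, mul_sum, sum_mul, prod_mul_distrib]
    refine sum_congr rfl fun v _ => ?_
    split_ifs <;> ring
  rw [sum_congr rfl fun s _ => e1 s, sum_comm]
  have e2 : ∑ t ∈ (P \ r).powerset, z (r ∪ t) * ∏ p ∈ t, (1 + β p * γ p) =
      ∑ v ∈ P.powerset with r ⊆ v, z v * ∏ p ∈ v \ r, (1 + β p * γ p) := by
    rw [sum_filter_superset hr]
    refine sum_congr rfl fun t ht => ?_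
    rw [union_sdiff_cancel_left (disjoint_of_subset_right (mem_powerset.1 ht) disjoint_sdiff)]
  rw [e2, mul_sum, sum_filter]
  refine sum_congr rfl fun v hv => ?_
  rw [mem_powerset] at hv
  by_cases hrv : r ⊆ v
  · rw [if_pos hrv, ← sum_filter, filter_filter]
    have e3 : P.powerset.filter (fun s => r ⊆ s ∧ s ⊆ v) = v.powerset.filter (fun s => r ⊆ s) := by
      ext s
      simp only [mem_filter, mem_powerset]
      exact ⟨fun h => ⟨h.2.2, h.2.1⟩, fun h => ⟨h.1.trans hv, h.2, h.1⟩⟩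
    rw [e3, sum_filter_superset hrv, prod_one_add, mul_sum, mul_sum]
    refine sum_congr rfl fun t ht => ?_
    rw [prod_union (disjoint_of_subset_right (mem_powerset.1 ht) disjoint_sdiff)]
    ring
  · rw [if_neg hrv]
    refine sum_eq_zero fun s hs => if_neg fun hsv => hrv ((mem_filter.1 hs).2.trans hsv)

end Lattice

/-! ### The sieve weights and their two quadratic forms -/

/-- The sieve weight attached to a function `y` on finite sets of primes. -/
noncomputable def sieveWeight (P : Finset ℕ) (k : ℕ) (y : Finset ℕ → ℝ) (s : Finset ℕ) : ℝ :=
  (∏ p ∈ s, (-((p : ℝ) / k))) *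
    ∑ v ∈ P.powerset with s ⊆ v, y v * ∏ p ∈ v, ((k : ℝ) / (p - k))

lemma sieveWeight_quadraticForm {P : Finset ℕ} {k : ℕ} (hk : 0 < k) (hP : ∀ p ∈ P, k < p)
    (y : Finset ℕ → ℝ) :
    ∑ s ∈ P.powerset, ∑ t ∈ P.powerset, sieveWeight P k y s * sieveWeight P k y t *
      ∏ p ∈ s ∪ t, ((k : ℝ) / p) =
    ∑ r ∈ P.powerset, (∏ p ∈ r, ((k : ℝ) / (p - k))) * y r ^ 2 := by
  have hk' : (0 : ℝ) < k := by exact_mod_cast hk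
  have hp : ∀ p ∈ P, (k : ℝ) < p := fun p hp => by exact_mod_cast hP p hp
  rw [quadraticForm_eq_sum_sq P (fun p : ℕ => (k : ℝ) / p) fun p h => by
    have := hp p h
    have : (0 : ℝ) < p := by linarith
    positivity]
  refine sum_congr rfl fun r hr => ?_
  rw [mem_powerset] at hr
  have h := sum_superset_mobius P (fun p : ℕ => -((p : ℝ) / k)) (fun p : ℕ => (k : ℝ) / p)
    (fun v => y v * ∏ p ∈ v, ((k : ℝ) / (p - k))) hr
  simp only [sieveWeight]
  rw [h]
  have hβ : ∀ p ∈ P, -((p : ℝ) / k) * ((k : ℝ) / p) = -1 := fun p h => by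
    have := hp p h
    have : (0 : ℝ) < p := by linarith
    field_simp
  -- The local factor `1 + β γ` is zero, so only `t = ∅` survives: for this density the weights
  -- exactly invert the change of variables.
  rw [sum_eq_single ∅]
  · rw [union_empty, prod_empty, mul_one, mul_pow, mul_pow, ← prod_pow, ← prod_pow,
      mul_comm (y r ^ 2), ← mul_assoc, ← mul_assoc, ← prod_mul_distrib, ← prod_mul_distrib]
    congr 1
    refine prod_congr rfl fun p h => ?_
    rw [hβ p (hr h)]
    have h1 := hp p (hr h)
    have h2 : (0 : ℝ) < p := by linarith
    have h3 : (p : ℝ) - k ≠ 0 := by linarith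
    rw [inv_div]
    field_simp
  · intro t ht hne
    obtain ⟨p, hpt⟩ := nonempty_iff_ne_empty.2 hne
    rw [prod_eq_zero hpt, mul_zero]
    rw [hβ p (sdiff_subset (mem_powerset.1 ht hpt))]
    norm_num
  · intro h
    exact absurd (empty_mem_powerset _) h

/-- For the other density the inversion is not exact, and the diagonal variable becomes an average
of `y` over the supersets of `r`. This average raises the power of the logarithm by one. -/
lemma sieveWeight_quadraticForm_prime {P : Finset ℕ} {k : ℕ} (hk : 2 ≤ k) (hP : ∀ p ∈ P, k < p)
    (y : Finset ℕ → ℝ) :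
    ∑ s ∈ P.powerset, ∑ t ∈ P.powerset, sieveWeight P k y s * sieveWeight P k y t *
      ∏ p ∈ s ∪ t, (((k : ℝ) - 1) / (p - 1)) =
    ∑ r ∈ P.powerset, (∏ p ∈ r, (((k : ℝ) - 1) / (p - k))) *
      ((∏ p ∈ r, ((p : ℝ) / (p - 1))) *
        ∑ t ∈ (P \ r).powerset, (∏ p ∈ t, (1 / ((p : ℝ) - 1))) * y (r ∪ t)) ^ 2 := by
  have hk' : (2 : ℝ) ≤ k := by exact_mod_cast hk
  have hp : ∀ p ∈ P, (k : ℝ) < p := fun p hp => by exact_mod_cast hP p hp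
  rw [quadraticForm_eq_sum_sq P (fun p : ℕ => ((k : ℝ) - 1) / (p - 1)) fun p h => by
    have := hp p h
    have h1 : (0 : ℝ) < p - 1 := by linarith
    have h2 : (0 : ℝ) < k - 1 := by linarith
    positivity]
  refine sum_congr rfl fun r hr => ?_
  rw [mem_powerset] at hr
  have h := sum_superset_mobius P (fun p : ℕ => -((p : ℝ) / k))
    (fun p : ℕ => ((k : ℝ) - 1) / (p - 1)) (fun v => y v * ∏ p ∈ v, ((k : ℝ) / (p - k))) hr
  simp only [sieveWeight]
  rw [h]
  have e : ∑ t ∈ (P \ r).powerset, y (r ∪ t) * (∏ p ∈ r ∪ t, ((k : ℝ) / (p - k))) *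
      ∏ p ∈ t, (1 + -((p : ℝ) / k) * (((k : ℝ) - 1) / (p - 1))) =
      (∏ p ∈ r, ((k : ℝ) / (p - k))) *
        ∑ t ∈ (P \ r).powerset, (∏ p ∈ t, (1 / ((p : ℝ) - 1))) * y (r ∪ t) := by
    rw [mul_sum]
    refine sum_congr rfl fun t ht => ?_
    rw [mem_powerset] at ht
    rw [prod_union (disjoint_of_subset_right ht disjoint_sdiff)]
    -- The defect `1 + β γ` equals `(p-k)/(k(p-1))`, which against the factor `k/(p-k)` of the
    -- weight leaves `1/(p-1)`.
    have e2 : ∏ p ∈ t, (1 / ((p : ℝ) - 1)) = (∏ p ∈ t, ((k : ℝ) / (p - k))) *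
        ∏ p ∈ t, (1 + -((p : ℝ) / k) * (((k : ℝ) - 1) / (p - 1))) := by
      rw [← prod_mul_distrib]
      refine prod_congr rfl fun p h => ?_
      have h1 := hp p (sdiff_subset (ht h))
      have h2 : (p : ℝ) - k ≠ 0 := by linarith
      have h3 : (p : ℝ) - 1 ≠ 0 := by linarith
      have h4 : (k : ℝ) ≠ 0 := by linarith
      field_simp
      ring
    rw [e2]
    ring
  rw [e, mul_pow, mul_pow, mul_pow, ← mul_assoc, ← mul_assoc, ← mul_assoc, ← prod_pow, ← prod_pow,
    ← prod_pow, ← prod_mul_distrib, ← prod_mul_distrib, ← prod_mul_distrib]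
  congr 1
  refine prod_congr rfl fun p h => ?_
  have h1 := hp p (hr h)
  have h2 : (p : ℝ) - k ≠ 0 := by linarith
  have h3 : (p : ℝ) - 1 ≠ 0 := by linarith
  have h4 : (k : ℝ) ≠ 0 := by linarith
  have h5 : (k : ℝ) - 1 ≠ 0 := by linarith
  rw [inv_div]
  field_simp
  ring

lemma prod_primeFactors_div_eq {W : ℕ} (hW : 0 < W) :
    ∏ p ∈ W.primeFactors, ((p : ℝ) / (p - 1)) = W / W.totient := by
  have h := Nat.totient_eq_mul_prod_factors W
  have h' : (W.totient : ℝ) = W * ∏ p ∈ W.primeFactors, (1 - (p : ℝ)⁻¹) := by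
    have := congrArg (fun q : ℚ => (q : ℝ)) h
    push_cast at this
    exact this
  have hp : ∀ p ∈ W.primeFactors, (1 : ℝ) < p := fun p hp => by
    exact_mod_cast (Nat.prime_of_mem_primeFactors hp).one_lt
  have hW' : (0 : ℝ) < W := by exact_mod_cast hW
  have h1 : (∏ p ∈ W.primeFactors, ((p : ℝ) / (p - 1))) *
      ∏ p ∈ W.primeFactors, (1 - (p : ℝ)⁻¹) = 1 := by
    rw [← prod_mul_distrib]
    refine prod_eq_one fun p h => ?_
    have := hp p h
    have h2 : (p : ℝ) - 1 ≠ 0 := by linarith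
    field_simp
  have hφ : (0 : ℝ) < W.totient := by exact_mod_cast Nat.totient_pos.2 hW
  rw [eq_div_iff hφ.ne', h']
  calc _ = W * ((∏ p ∈ W.primeFactors, ((p : ℝ) / (p - 1))) *
      ∏ p ∈ W.primeFactors, (1 - (p : ℝ)⁻¹)) := by ring
    _ = W := by rw [h1, mul_one]

/-- The lower bound for the transformed weights. -/
lemma le_prod_mul_sum_truncLog {W : ℕ} (hW : 0 < W) (l : ℕ) {P : Finset ℕ} {R : ℝ} (hR : 0 < R)
    (hP : ∀ p : ℕ, p ∈ P ↔ p.Prime ∧ (p : ℝ) ≤ R ∧ ¬ p ∣ W) {r : Finset ℕ} (hr : r ⊆ P) :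
    (W.totient : ℝ) / W * (truncLog (l + 1) (R / ∏ p ∈ r, (p : ℝ)) / (l + 1)) ≤
      (∏ p ∈ r, ((p : ℝ) / (p - 1))) *
        ∑ t ∈ (P \ r).powerset, (∏ p ∈ t, (1 / ((p : ℝ) - 1))) *
          truncLog l (R / ∏ p ∈ r ∪ t, (p : ℝ)) := by
  have hprime : ∀ p ∈ P, p.Prime := fun p hp => ((hP p).1 hp).1
  have hrpos : (1 : ℝ) ≤ ∏ p ∈ r, (p : ℝ) :=
    one_le_prod fun p hp => by exact_mod_cast (hprime p (hr hp)).one_lt.le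
  set x : ℝ := R / ∏ p ∈ r, (p : ℝ) with hx
  have hx0 : 0 < x := by positivity
  have hxR : x ≤ R := div_le_self hR.le hrpos
  have hdisj : Disjoint W.primeFactors r := by
    rw [disjoint_left]
    intro p hp hpr
    exact ((hP p).1 (hr hpr)).2.2 (Nat.dvd_of_mem_primeFactors hp)
  -- The primes of `W` and of `r` are summed out freely. Those of `r` give the factor already
  -- present in the claim; those of `W` give `W/φ(W)`, cancelled by `φ(W)/W`.
  have h := sum_inv_mul_primeFactors_le (P := P \ r) (Q := W.primeFactors ∪ r)
    (S := Icc 1 ⌊x⌋₊) (fun p hp => hprime p (sdiff_subset hp))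
    (fun p hp => (mem_union.1 hp).elim Nat.prime_of_mem_primeFactors fun h => hprime p (hr h))
    (by
      rw [disjoint_left]
      intro p hp hp'
      rw [mem_sdiff] at hp
      rcases mem_union.1 hp' with h | h
      · exact ((hP p).1 hp.1).2.2 (Nat.dvd_of_mem_primeFactors h)
      · exact hp.2 h)
    (by
      intro n hn
      rw [mem_Icc] at hn
      refine ⟨by omega, fun p hp => ?_⟩
      have hpp := Nat.prime_of_mem_primeFactors hp
      have hpn : p ≤ ⌊x⌋₊ := (Nat.le_of_dvd hn.1 (Nat.dvd_of_mem_primeFactors hp)).trans hn.2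
      have hpx : (p : ℝ) ≤ R := ((Nat.le_floor_iff hx0.le).1 hpn).trans hxR
      by_cases hpW : p ∣ W
      · exact mem_union_right _ (mem_union_left _ (Nat.mem_primeFactors.2 ⟨hpp, hpW, hW.ne'⟩))
      · by_cases hpr : p ∈ r
        · exact mem_union_right _ (mem_union_right _ hpr)
        · exact mem_union_left _ (mem_sdiff.2 ⟨(hP p).2 ⟨hpp, hpx, hpW⟩, hpr⟩))
    (fun u => truncLog l (x / ∏ p ∈ u, (p : ℝ))) (fun u => truncLog_nonneg _ _)
  rw [prod_union hdisj, prod_primeFactors_div_eq hW] at h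
  have hlow : truncLog (l + 1) x / (l + 1) ≤
      ∑ n ∈ Icc 1 ⌊x⌋₊, (1 / (n : ℝ)) *
        truncLog l (x / ∏ p ∈ n.primeFactors \ (W.primeFactors ∪ r), (p : ℝ)) := by
    refine (truncLog_le_sum l hx0).trans (sum_le_sum fun n hn => ?_)
    rw [mem_Icc] at hn
    refine mul_le_mul_of_nonneg_left (truncLog_mono l ?_) (by positivity)
    have hsub : n.primeFactors \ (W.primeFactors ∪ r) ⊆ n.primeFactors := sdiff_subset
    have h1 := Nat.le_of_dvd hn.1 (prod_dvd_of_subset_primeFactors hsub)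
    have h2 : ∏ p ∈ n.primeFactors \ (W.primeFactors ∪ r), (p : ℝ) ≤ n := by
      have := (Nat.cast_le (α := ℝ)).2 h1
      push_cast at this
      exact this
    have h3 : 0 < ∏ p ∈ n.primeFactors \ (W.primeFactors ∪ r), (p : ℝ) := prod_pos fun p hp => by
      exact_mod_cast (Nat.prime_of_mem_primeFactors (hsub hp)).pos
    gcongr
  have hW' : (0 : ℝ) < W := by exact_mod_cast hW
  have hφ : (0 : ℝ) < W.totient := by exact_mod_cast Nat.totient_pos.2 hW
  refine (mul_le_mul_of_nonneg_left (hlow.trans h) (by positivity)).trans (le_of_eq ?_)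
  have e : ∑ t ∈ (P \ r).powerset, (∏ p ∈ t, (1 / ((p : ℝ) - 1))) *
          truncLog l (R / ∏ p ∈ r ∪ t, (p : ℝ)) =
      ∑ t ∈ (P \ r).powerset, (∏ p ∈ t, (1 / ((p : ℝ) - 1))) *
          truncLog l (x / ∏ p ∈ t, (p : ℝ)) := by
    refine sum_congr rfl fun t ht => ?_
    rw [prod_union (disjoint_of_subset_right (mem_powerset.1 ht) disjoint_sdiff), hx, div_div]
  rw [e]
  field_simp

/-- Squaring the bound for the diagonal variables gives `truncLog (2(l+1))`. The weights
`(k-1)/(p-k)` dominate `(k-1)/(p-(k-1))`, those for which `coprimeSum_le_sum_powerset` is stated. -/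
lemma quadraticForm_prime_ge {W : ℕ} (hW : 0 < W) {k : ℕ} (hk : 2 ≤ k) (l : ℕ) {P : Finset ℕ}
    {R : ℝ} (hR : 0 < R) (hP : ∀ p : ℕ, p ∈ P ↔ p.Prime ∧ (p : ℝ) ≤ R ∧ ¬ p ∣ W)
    (hkP : ∀ p ∈ P, k < p) :
    ((W.totient : ℝ) / W / (l + 1)) ^ 2 * coprimeSum W (2 * (l + 1)) (k - 1) R ≤
    ∑ s ∈ P.powerset, ∑ t ∈ P.powerset,
      sieveWeight P k (fun v => truncLog l (R / ∏ p ∈ v, (p : ℝ))) s *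
      sieveWeight P k (fun v => truncLog l (R / ∏ p ∈ v, (p : ℝ))) t *
      ∏ p ∈ s ∪ t, (((k : ℝ) - 1) / (p - 1)) := by
  rw [sieveWeight_quadraticForm_prime hk hkP]
  have h := coprimeSum_le_sum_powerset W (2 * (l + 1)) (k - 1) (P := P)
    (fun p hp => ⟨((hP p).1 hp).1, (Nat.sub_le k 1).trans_lt (hkP p hp)⟩) R
    (fun p hp hpR hpW => (hP p).2 ⟨hp, hpR, hpW⟩)
  refine (mul_le_mul_of_nonneg_left h (by positivity)).trans ?_
  rw [mul_sum]
  have hk1 : ((k - 1 : ℕ) : ℝ) = k - 1 := by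
    rw [Nat.cast_sub (by omega)]
    simp
  have hk2 : (2 : ℝ) ≤ k := by exact_mod_cast hk
  refine sum_le_sum fun r hr => ?_
  rw [mem_powerset] at hr
  have h1 := le_prod_mul_sum_truncLog hW l hR hP hr
  have h2 : 0 ≤ (W.totient : ℝ) / W * (truncLog (l + 1) (R / ∏ p ∈ r, (p : ℝ)) / (l + 1)) :=
    mul_nonneg (by positivity) (div_nonneg (truncLog_nonneg _ _) (by positivity))
  have h3 := pow_le_pow_left₀ h2 h1 2
  have h4 : ∏ p ∈ r, (((k - 1 : ℕ) : ℝ) / (p - (k - 1 : ℕ))) ≤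
      ∏ p ∈ r, (((k : ℝ) - 1) / (p - k)) := by
    refine prod_le_prod (fun p hp => ?_) fun p hp => ?_
    all_goals
      have h5 : (k : ℝ) < p := by exact_mod_cast hkP p (hr hp)
      rw [hk1]
    · exact div_nonneg (by linarith) (by linarith)
    · exact div_le_div_of_nonneg_left (by linarith) (by linarith) (by linarith)
  have h6 : 0 ≤ ∏ p ∈ r, (((k : ℝ) - 1) / (p - k)) := prod_nonneg fun p hp => by
    have h5 : (k : ℝ) < p := by exact_mod_cast hkP p (hr hp)
    exact div_nonneg (by linarith) (by linarith)
  calc _ = (∏ p ∈ r, (((k - 1 : ℕ) : ℝ) / (p - (k - 1 : ℕ)))) *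
        ((W.totient : ℝ) / W * (truncLog (l + 1) (R / ∏ p ∈ r, (p : ℝ)) / (l + 1))) ^ 2 := by
        rw [← truncLog_sq]
        ring
    _ ≤ _ := mul_le_mul h4 h3 (sq_nonneg _) h6

lemma quadraticForm_le {W : ℕ} {k D : ℕ} (hk : 0 < k) (hD : 0 < D) (hkD : 2 * k ≤ D) (l : ℕ)
    {P : Finset ℕ} {R : ℝ} (hR : 0 ≤ R) (hP : ∀ p ∈ P, p.Prime ∧ ¬ p ∣ W ∧ D < p) :
    ∑ s ∈ P.powerset, ∑ t ∈ P.powerset,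
      sieveWeight P k (fun v => truncLog l (R / ∏ p ∈ v, (p : ℝ))) s *
      sieveWeight P k (fun v => truncLog l (R / ∏ p ∈ v, (p : ℝ))) t *
      ∏ p ∈ s ∪ t, ((k : ℝ) / p) ≤
    Real.exp (2 * k ^ 2 / D) * coprimeSum W (2 * l) k R := by
  have hkP : ∀ p ∈ P, k < p := fun p hp => by
    have := (hP p hp).2.2
    omega
  rw [sieveWeight_quadraticForm hk hkP]
  simp only [truncLog_sq]
  refine (sum_powerset_shifted_le_coprimeSum W (2 * l) k
    (fun p hp => ⟨(hP p hp).1, (hP p hp).2.1, hkP p hp⟩) R hR).trans ?_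
  exact mul_le_mul_of_nonneg_right (prod_one_add_div_le_exp hD hkD fun p hp => (hP p hp).2.2)
    (coprimeSum_nonneg _ _ _ _)

/-- The size of the sieve weights. -/
lemma abs_sieveWeight_le {k : ℕ} (hk : 0 < k) (l : ℕ) {P : Finset ℕ} {R : ℝ}
    (hR : 1 ≤ R) (hP : ∀ p ∈ P, p.Prime ∧ 2 * k ≤ p) {s : Finset ℕ} (hs : s ⊆ P) :
    |sieveWeight P k (fun v => truncLog l (R / ∏ p ∈ v, (p : ℝ))) s| ≤
      (2 : ℝ) ^ s.card * (1 + Real.log R) ^ (l + 2 * k) := by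
  have hk' : (0 : ℝ) < k := by exact_mod_cast hk
  have hp : ∀ p ∈ P, 2 * (k : ℝ) ≤ p := fun p h => by exact_mod_cast (hP p h).2
  have hL := Real.log_nonneg hR
  have hone : ∀ u, u ⊆ P → (1 : ℝ) ≤ ∏ p ∈ u, (p : ℝ) := fun u hu =>
    one_le_prod fun p h => by exact_mod_cast (hP p (hu h)).1.one_lt.le
  have hnn : ∀ u, u ⊆ P → 0 ≤ ∏ p ∈ u, ((k : ℝ) / (p - k)) := fun u hu =>
    prod_nonneg fun p h => div_nonneg hk'.le (by linarith [hp p (hu h)])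
  rw [sieveWeight, sum_filter_superset hs, abs_mul, abs_prod]
  rw [abs_of_nonneg (sum_nonneg fun t ht => mul_nonneg (truncLog_nonneg _ _)
    (hnn _ (union_subset hs ((mem_powerset.1 ht).trans sdiff_subset))))]
  have hterm : ∀ t ∈ (P \ s).powerset, truncLog l (R / ∏ p ∈ s ∪ t, (p : ℝ)) *
      ∏ p ∈ s ∪ t, ((k : ℝ) / (p - k)) ≤ (∏ p ∈ s, ((k : ℝ) / (p - k))) *
        ((1 + Real.log R) ^ l * ((∏ p ∈ t, (((2 * k : ℕ) : ℝ) / p)) *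
          truncLog 0 (R / ∏ p ∈ t, (p : ℝ)))) := by
    intro t ht
    rw [mem_powerset] at ht
    have htP := ht.trans sdiff_subset
    have hd : Disjoint s t := disjoint_of_subset_right ht disjoint_sdiff
    rw [prod_union hd, prod_union hd]
    have h1 : ∏ p ∈ t, ((k : ℝ) / (p - k)) ≤ ∏ p ∈ t, (((2 * k : ℕ) : ℝ) / p) := by
      refine prod_le_prod (fun p h => div_nonneg hk'.le (by linarith [hp p (htP h)])) fun p h => ?_
      have h2 := hp p (htP h)
      rw [div_le_div_iff₀ (by linarith) (by linarith)]
      push_cast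
      nlinarith
    have h3 : truncLog l (R / ((∏ p ∈ s, (p : ℝ)) * ∏ p ∈ t, (p : ℝ))) ≤
        (1 + Real.log R) ^ l * truncLog 0 (R / ∏ p ∈ t, (p : ℝ)) := by
      have hs1 := hone s hs
      have ht1 := hone t htP
      have hle : R / ((∏ p ∈ s, (p : ℝ)) * ∏ p ∈ t, (p : ℝ)) ≤ R / ∏ p ∈ t, (p : ℝ) := by
        refine div_le_div_of_nonneg_left (by linarith) (by linarith) ?_
        exact le_mul_of_one_le_left (by linarith) hs1
      refine (truncLog_mono l hle).trans ?_
      rcases lt_or_ge (R / ∏ p ∈ t, (p : ℝ)) 1 with h | h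
      · rw [truncLog_of_lt_one h, truncLog_of_lt_one h, mul_zero]
      · rw [truncLog_of_one_le h, truncLog_of_one_le h, pow_zero, mul_one]
        have h4 : Real.log (R / ∏ p ∈ t, (p : ℝ)) ≤ Real.log R :=
          Real.log_le_log (by linarith) (div_le_self (by linarith) ht1)
        exact pow_le_pow_left₀ (Real.log_nonneg h) (by linarith) l
    have h5 := truncLog_nonneg 0 (R / ∏ p ∈ t, (p : ℝ))
    calc _ ≤ ((1 + Real.log R) ^ l * truncLog 0 (R / ∏ p ∈ t, (p : ℝ))) *
          ((∏ p ∈ s, ((k : ℝ) / (p - k))) * ∏ p ∈ t, (((2 * k : ℕ) : ℝ) / p)) := by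
          refine mul_le_mul h3 (mul_le_mul_of_nonneg_left h1 (hnn s hs))
            (mul_nonneg (hnn s hs) (hnn t htP)) (mul_nonneg (by positivity) h5)
      _ = _ := by ring
  -- Modulus 1 imposes no coprimality condition, so the crude bound for `coprimeSum` with `2k`
  -- variables applies.
  have hsum : ∑ t ∈ (P \ s).powerset, (∏ p ∈ t, (((2 * k : ℕ) : ℝ) / p)) *
          truncLog 0 (R / ∏ p ∈ t, (p : ℝ)) ≤ (1 + Real.log R) ^ (2 * k) :=
    (sum_powerset_le_coprimeSum 1 0 (2 * k) (fun p h => by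
      have hpp := (hP p (sdiff_subset h)).1
      exact ⟨hpp, hpp.one_lt.not_ge ∘ Nat.le_of_dvd one_pos⟩) R).trans
      (coprimeSum_zero_le 1 (2 * k) hR)
  have hfac : (∏ p ∈ s, |-((p : ℝ) / k)|) * ∏ p ∈ s, ((k : ℝ) / (p - k)) ≤ 2 ^ s.card := by
    rw [← prod_mul_distrib, ← prod_const]
    refine prod_le_prod (fun p h => mul_nonneg (abs_nonneg _)
      (div_nonneg hk'.le (by linarith [hp p (hs h)]))) fun p h => ?_
    have h2 := hp p (hs h)
    have h3 : (0 : ℝ) < p - k := by linarith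
    rw [abs_neg, abs_of_nonneg (by positivity), div_mul_div_comm, mul_comm (k : ℝ) (p - k),
      div_le_iff₀ (by positivity)]
    nlinarith
  have habs : 0 ≤ ∏ p ∈ s, |-((p : ℝ) / k)| := prod_nonneg fun _ _ => abs_nonneg _
  calc _ ≤ (∏ p ∈ s, |-((p : ℝ) / k)|) * ((∏ p ∈ s, ((k : ℝ) / (p - k))) *
        ((1 + Real.log R) ^ l * (1 + Real.log R) ^ (2 * k))) := by
        refine mul_le_mul_of_nonneg_left ((sum_le_sum hterm).trans ?_) habs
        rw [← mul_sum, ← mul_sum]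
        refine mul_le_mul_of_nonneg_left ?_ (hnn s hs)
        exact mul_le_mul_of_nonneg_left hsum (by positivity)
    _ = ((∏ p ∈ s, |-((p : ℝ) / k)|) * ∏ p ∈ s, ((k : ℝ) / (p - k))) *
        (1 + Real.log R) ^ (l + 2 * k) := by ring
    _ ≤ _ := mul_le_mul_of_nonneg_right hfac (by positivity)

lemma sieveWeight_eq_zero {k l : ℕ} {P : Finset ℕ} {R : ℝ} (hR : 0 ≤ R)
    (hP : ∀ p ∈ P, p.Prime) {s : Finset ℕ} (hs : R < ∏ p ∈ s, (p : ℝ)) :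
    sieveWeight P k (fun v => truncLog l (R / ∏ p ∈ v, (p : ℝ))) s = 0 := by
  rw [sieveWeight, sum_eq_zero, mul_zero]
  intro v hv
  rw [mem_filter, mem_powerset] at hv
  have h1 : ∏ p ∈ s, (p : ℝ) ≤ ∏ p ∈ v, (p : ℝ) :=
by
    have h2 := Nat.le_of_dvd (prod_pos fun p hp => (hP p (hv.1 hp)).pos)
      (prod_dvd_prod_of_subset _ _ (fun p : ℕ => p) hv.2)
    have h3 := (Nat.cast_le (α := ℝ)).2 h2
    push_cast at h3
    exact h3
  rw [truncLog_of_lt_one, zero_mul]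
  rw [div_lt_one (by linarith)]
  linarith

/-! ### Residue classes defined by local conditions -/

section Residues

variable (W : ℕ) (u : Finset ℕ) (Ω : (p : ℕ) → Finset (ZMod p))

/-- The condition `n ≡ 1 (mod W)` together with `n mod p ∈ Ω p` for every `p ∈ u`. -/
def InResidues (n : ℕ) : Prop := n ≡ 1 [MOD W] ∧ ∀ p ∈ u, (n : ZMod p) ∈ Ω p

instance : DecidablePred (InResidues W u Ω) := fun n => by
  unfold InResidues
  infer_instance

/-- The representatives in `[0, W ∏ p)` of the residue classes described by `InResidues`. -/
def residueSystem : Finset ℕ := (range (W * ∏ p ∈ u, p)).filter (InResidues W u Ω)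

variable {W u Ω}

lemma inResidues_congr {m n : ℕ} (h : m ≡ n [MOD W * ∏ p ∈ u, p]) :
    InResidues W u Ω m ↔ InResidues W u Ω n := by
  have h1 : m ≡ n [MOD W] := h.of_dvd (dvd_mul_right _ _)
  have h2 : ∀ p ∈ u, (m : ZMod p) = n := fun p hp =>
    (ZMod.natCast_eq_natCast_iff _ _ _).2 (h.of_dvd ((dvd_prod_of_mem _ hp).mul_left _))
  unfold InResidues
  refine and_congr ⟨fun h => h1.symm.trans h, fun h => h1.trans h⟩ ?_
  exact forall₂_congr fun p hp => by rw [h2 p hp]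

lemma card_filter_range_natCast_mem {p : ℕ} (hp : 0 < p) (S : Finset (ZMod p)) :
    ((range p).filter fun b : ℕ => (b : ZMod p) ∈ S).card = S.card := by
  have : NeZero p := ⟨hp.ne'⟩
  refine card_bij (fun b _ => (b : ZMod p)) (fun b hb => (mem_filter.1 hb).2) ?_ ?_
  · intro a ha b hb hab
    rw [mem_filter, mem_range] at ha hb
    exact Nat.ModEq.eq_of_lt_of_lt ((ZMod.natCast_eq_natCast_iff _ _ _).1 hab) ha.1 hb.1
  · intro x hx
    refine ⟨x.val, ?_, ZMod.natCast_zmod_val x⟩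
    rw [mem_filter, mem_range, ZMod.natCast_zmod_val]
    exact ⟨ZMod.val_lt x, hx⟩

/-- Chinese remainder theorem, one prime at a time: a residue modulo `q p` corresponds to its pair
of residues modulo `q` and `p`. -/
lemma card_residueSystem (hW : 0 < W) (hu : ∀ p ∈ u, p.Prime ∧ ¬ p ∣ W) :
    (residueSystem W u Ω).card = ∏ p ∈ u, (Ω p).card := by
  induction u using Finset.induction_on with
  | empty =>
    rw [prod_empty, card_eq_one]
    refine ⟨1 % W, ?_⟩
    ext a
    simp only [residueSystem, InResidues, prod_empty, mul_one, mem_filter, mem_range,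
      notMem_empty, false_imp_iff, implies_true, and_true, mem_singleton]
    constructor
    · rintro ⟨h1, h2⟩
      rwa [Nat.ModEq, Nat.mod_eq_of_lt h1] at h2
    · rintro rfl
      exact ⟨Nat.mod_lt _ hW, Nat.mod_modEq _ _⟩
  | insert p u hpu ih =>
    have hpp := (hu p (mem_insert_self _ _)).1
    have hpW := (hu p (mem_insert_self _ _)).2
    have ih' := ih fun x hx => hu x (mem_insert_of_mem hx)
    set q := W * ∏ x ∈ u, x with hq
    have hq0 : 0 < q := Nat.mul_pos hW (prod_pos fun x hx => (hu x (mem_insert_of_mem hx)).1.pos)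
    have hcop : Nat.Coprime q p := by
      refine Nat.Coprime.mul_left ((hpp.coprime_iff_not_dvd.2 hpW).symm) ?_
      refine Nat.Coprime.prod_left fun x hx => ?_
      refine (Nat.coprime_primes (hu x (mem_insert_of_mem hx)).1 hpp).2 ?_
      rintro rfl
      exact hpu hx
    have hqp : W * ∏ x ∈ insert p u, x = q * p := by
      rw [prod_insert hpu, hq]
      ring
    have hiff : ∀ n, InResidues W (insert p u) Ω n ↔ InResidues W u Ω n ∧ (n : ZMod p) ∈ Ω p := by
      intro n
      unfold InResidues
      rw [forall_mem_insert]
      tauto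
    rw [prod_insert hpu, ← ih', ← card_filter_range_natCast_mem hpp.pos (Ω p), mul_comm,
      ← card_product]
    refine card_bij (fun a _ => (a % q, a % p)) ?_ ?_ ?_
    · intro a ha
      rw [residueSystem, mem_filter, hiff] at ha
      rw [mem_product, residueSystem, mem_filter, mem_filter, mem_range, mem_range]
      refine ⟨⟨Nat.mod_lt _ hq0, (inResidues_congr (Nat.mod_modEq _ _)).2 ha.2.1⟩,
        Nat.mod_lt _ hpp.pos, ?_⟩
      rw [ZMod.natCast_mod]
      exact ha.2.2
    · intro a ha b hb hab
      rw [residueSystem, mem_filter, mem_range, hqp] at ha hb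
      rw [Prod.mk.injEq] at hab
      exact Nat.ModEq.eq_of_lt_of_lt
        ((Nat.modEq_and_modEq_iff_modEq_mul hcop).1 ⟨hab.1, hab.2⟩) ha.1 hb.1
    · rintro ⟨b, c⟩ hbc
      rw [mem_product, residueSystem, mem_filter, mem_filter, mem_range, mem_range] at hbc
      obtain ⟨⟨hb1, hb2⟩, hc1, hc2⟩ := hbc
      set a := Nat.chineseRemainder hcop b c with ha
      have ha1 : (a : ℕ) ≡ b [MOD q] := a.2.1
      have ha2 : (a : ℕ) ≡ c [MOD p] := a.2.2
      refine ⟨a, ?_, ?_⟩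
      · rw [residueSystem, mem_filter, mem_range, hqp, hiff]
        refine ⟨Nat.chineseRemainder_lt_mul hcop b c hq0.ne' hpp.ne_zero,
          (inResidues_congr ha1).2 hb2, ?_⟩
        rw [(ZMod.natCast_eq_natCast_iff _ _ _).2 ha2]
        exact hc2
      · rw [Prod.mk.injEq]
        refine ⟨?_, ?_⟩
        · exact Eq.trans ha1 (Nat.mod_eq_of_lt hb1)
        · exact Eq.trans ha2 (Nat.mod_eq_of_lt hc1)

lemma sum_filter_inResidues (hq : 0 < W * ∏ p ∈ u, p) (I : Finset ℕ) (f : ℕ → ℝ) :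
    ∑ n ∈ I with InResidues W u Ω n, f n =
      ∑ r ∈ residueSystem W u Ω, ∑ n ∈ I with n ≡ r [MOD W * ∏ p ∈ u, p], f n := by
  have hmaps : ∀ n ∈ I.filter (InResidues W u Ω),
      n % (W * ∏ p ∈ u, p) ∈ residueSystem W u Ω := by
    intro n hn
    rw [residueSystem, mem_filter, mem_range]
    exact ⟨Nat.mod_lt _ hq, (inResidues_congr (Nat.mod_modEq _ _)).2 (mem_filter.1 hn).2⟩
  rw [← sum_fiberwise_of_maps_to hmaps]
  refine sum_congr rfl fun r hr => sum_congr ?_ fun _ _ => rfl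
  rw [residueSystem, mem_filter, mem_range] at hr
  ext n
  rw [mem_filter, mem_filter, mem_filter]
  constructor
  · rintro ⟨⟨h1, -⟩, h2⟩
    refine ⟨h1, ?_⟩
    rw [Nat.ModEq, h2, Nat.mod_eq_of_lt hr.1]
  · rintro ⟨h1, h2⟩
    refine ⟨⟨h1, (inResidues_congr h2).2 hr.2⟩, ?_⟩
    rwa [Nat.ModEq, Nat.mod_eq_of_lt hr.1] at h2

lemma coprime_of_mem_residueSystem (hu : ∀ p ∈ u, p.Prime)
    (h0 : ∀ p ∈ u, (0 : ZMod p) ∉ Ω p) {r : ℕ} (hr : r ∈ residueSystem W u Ω) :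
    r.Coprime (W * ∏ p ∈ u, p) := by
  rw [residueSystem, mem_filter] at hr
  obtain ⟨-, h1, h2⟩ := hr
  refine Nat.Coprime.mul_right ?_ (Nat.Coprime.prod_right fun p hp => ?_)
  · have := h1.gcd_eq
    rwa [Nat.gcd_one_left] at this
  · rw [Nat.coprime_comm, (hu p hp).coprime_iff_not_dvd]
    intro hd
    have := h2 p hp
    rw [(ZMod.natCast_eq_zero_iff _ _).2 hd] at this
    exact h0 p hp this

end Residues

/-! ### Integers and primes in these classes -/

lemma abs_card_modEq_sub_le {a b q : ℕ} (hab : a ≤ b) (hq : 0 < q) (v : ℕ) :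
    |(((Ioc a b).filter fun n => n ≡ v [MOD q]).card : ℝ) - ((b : ℝ) - a) / q| ≤ 1 := by
  have h := Nat.Ioc_filter_modEq_card a b hq v
  have hq' : (0 : ℚ) < q := by exact_mod_cast hq
  have hle : ⌊((a : ℚ) - v) / q⌋ ≤ ⌊((b : ℚ) - v) / q⌋ := by
    refine Int.floor_le_floor ?_
    have : (a : ℚ) ≤ b := by exact_mod_cast hab
    gcongr
  rw [max_eq_left (by linarith)] at h
  have h1 := Int.floor_le (((a : ℚ) - v) / q)
  have h2 := Int.lt_floor_add_one (((a : ℚ) - v) / q)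
  have h3 := Int.floor_le (((b : ℚ) - v) / q)
  have h4 := Int.lt_floor_add_one (((b : ℚ) - v) / q)
  have h5 : |(((Ioc a b).filter fun n => n ≡ v [MOD q]).card : ℚ) - ((b : ℚ) - a) / q| ≤ 1 := by
    have h6 : (((Ioc a b).filter fun n => n ≡ v [MOD q]).card : ℚ) =
        (⌊((b : ℚ) - v) / q⌋ : ℚ) - ⌊((a : ℚ) - v) / q⌋ := by exact_mod_cast h
    have h7 : ((b : ℚ) - a) / q = ((b : ℚ) - v) / q - ((a : ℚ) - v) / q := by ring
    rw [h6, h7, abs_le]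
    constructor <;> linarith
  have h8 := (Rat.cast_le (K := ℝ)).2 h5
  push_cast at h8
  exact h8

lemma abs_card_inResidues_sub_le {W : ℕ} {u : Finset ℕ} {Ω : (p : ℕ) → Finset (ZMod p)}
    (hW : 0 < W) (hu : ∀ p ∈ u, p.Prime ∧ ¬ p ∣ W) {k : ℕ} (hΩ : ∀ p ∈ u, (Ω p).card = k)
    {a b : ℕ} (hab : a ≤ b) :
    |∑ n ∈ Ioc a b with InResidues W u Ω n, (1 : ℝ) -
      ((b : ℝ) - a) / W * ∏ p ∈ u, ((k : ℝ) / p)| ≤ (k : ℝ) ^ u.card := by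
  have hprod : 0 < ∏ p ∈ u, p := prod_pos fun p hp => (hu p hp).1.pos
  have hq : 0 < W * ∏ p ∈ u, p := Nat.mul_pos hW hprod
  have hcard : (residueSystem W u Ω).card = k ^ u.card := by
    rw [card_residueSystem hW hu, prod_congr rfl hΩ, prod_const]
  rw [sum_filter_inResidues hq]
  have e : ((b : ℝ) - a) / W * ∏ p ∈ u, ((k : ℝ) / p) =
      ∑ r ∈ residueSystem W u Ω, ((b : ℝ) - a) / (W * ∏ p ∈ u, p : ℕ) := by
    rw [sum_const, hcard, nsmul_eq_mul, prod_div_distrib, prod_const]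
    push_cast
    field_simp
  rw [e, ← sum_sub_distrib]
  refine (abs_sum_le_sum_abs _ _).trans ?_
  calc _ ≤ ∑ r ∈ residueSystem W u Ω, (1 : ℝ) := by
        refine sum_le_sum fun r _ => ?_
        have := abs_card_modEq_sub_le hab hq r
        simpa using this
    _ = _ := by simp [hcard]

lemma totient_mul_prod {W : ℕ} {u : Finset ℕ} (hu : ∀ p ∈ u, p.Prime ∧ ¬ p ∣ W) :
    (Nat.totient (W * ∏ p ∈ u, p) : ℝ) = W.totient * ∏ p ∈ u, ((p : ℝ) - 1) := by
  induction u using Finset.induction_on with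
  | empty => simp
  | insert p u hpu ih =>
    have hpp := (hu p (mem_insert_self _ _)).1
    have hpW := (hu p (mem_insert_self _ _)).2
    have hcop : Nat.Coprime p (W * ∏ x ∈ u, x) := by
      refine Nat.Coprime.mul_right (hpp.coprime_iff_not_dvd.2 hpW) ?_
      refine Nat.Coprime.prod_right fun x hx => ?_
      refine (Nat.coprime_primes hpp (hu x (mem_insert_of_mem hx)).1).2 ?_
      rintro rfl
      exact hpu hx
    rw [prod_insert hpu, prod_insert hpu, mul_left_comm, Nat.totient_mul hcop, Nat.cast_mul,
      ih fun x hx => hu x (mem_insert_of_mem hx), Nat.totient_prime hpp,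
      Nat.cast_sub hpp.one_lt.le]
    push_cast
    ring

lemma primeLog_nonneg (n : ℕ) : 0 ≤ primeLog n := by
  unfold primeLog
  split_ifs
  · exact Real.log_natCast_nonneg n
  · exact le_rfl

lemma primeLog_le {n : ℕ} {x : ℝ} (hx : (n : ℝ) ≤ x) (hx1 : 1 ≤ x) : primeLog n ≤ Real.log x := by
  unfold primeLog
  split_ifs with h
  · exact Real.log_le_log (by exact_mod_cast h.pos) hx
  · exact Real.log_nonneg hx1

/-- The trivial bound for the error in the distribution of primes in progressions. -/
lemma maxError_le {x : ℝ} {q : ℕ} (hq : 0 < q) (hqx : (q : ℝ) ≤ x) :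
    maxError x q ≤ ENNReal.ofReal (3 * x / q * Real.log (2 * x) + x / q.totient) := by
  have hq' : (1 : ℝ) ≤ q := by exact_mod_cast hq
  have hlog : 0 ≤ Real.log (2 * x) := Real.log_nonneg (by linarith)
  refine iSup_le fun y => iSup_le fun hy => iSup_le fun a => iSup_le fun _ => ?_
  refine ENNReal.ofReal_le_ofReal ?_
  have hfl : ⌊y⌋₊ ≤ ⌊2 * y⌋₊ := Nat.floor_le_floor (by linarith)
  have hθ0 : 0 ≤ thetaStar y a q := sum_nonneg fun n _ => primeLog_nonneg n
  have hcount : (((Ioc ⌊y⌋₊ ⌊2 * y⌋₊).filter fun n => n ≡ a [MOD q]).card : ℝ) ≤ 3 * x / q := by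
    have h := (abs_le.1 (abs_card_modEq_sub_le hfl hq a)).2
    have h1 : (⌊2 * y⌋₊ : ℝ) ≤ 2 * y := Nat.floor_le (by linarith)
    have h2 : y < ⌊y⌋₊ + 1 := Nat.lt_floor_add_one y
    have h3 : ((⌊2 * y⌋₊ : ℝ) - ⌊y⌋₊) / q ≤ 2 * x / q := by
      gcongr
      linarith
    have h4 : 1 ≤ x / q := (one_le_div (by linarith)).2 hqx
    have h5 : 3 * x / q = 2 * x / q + x / q := by ring
    linarith
  have hθ : thetaStar y a q ≤ 3 * x / q * Real.log (2 * x) := by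
    calc thetaStar y a q ≤ ∑ n ∈ (Ioc ⌊y⌋₊ ⌊2 * y⌋₊).filter (fun n => n ≡ a [MOD q]),
          Real.log (2 * x) := by
          refine sum_le_sum fun n hn => primeLog_le ?_ (by linarith)
          rw [mem_filter, mem_Ioc] at hn
          have h1 : (n : ℝ) ≤ 2 * y := (Nat.le_floor_iff (by linarith)).1 hn.1.2
          linarith
      _ ≤ _ := by
          rw [sum_const, nsmul_eq_mul]
          gcongr
  have hy1 : 0 ≤ y / (q.totient : ℝ) := div_nonneg hy.1.le (by positivity)
  have hy2 : y / (q.totient : ℝ) ≤ x / q.totient := by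
    gcongr
    exact hy.2
  rw [abs_le]
  constructor <;> linarith

/-- The trivial bound makes the supremum finite, so that `toReal` does not collapse it to 0. Only `y
= x` is needed. -/
lemma abs_thetaStar_sub_le {x : ℝ} (hx : 0 < x) {q a : ℕ} (hq : 0 < q) (hqx : (q : ℝ) ≤ x)
    (ha : a.Coprime q) :
    |thetaStar x a q - x / (q.totient : ℝ)| ≤ (maxError x q).toReal := by
  rw [← ENNReal.ofReal_le_iff_le_toReal
    (ne_top_of_le_ne_top ENNReal.ofReal_ne_top (maxError_le hq hqx))]
  refine le_trans ?_ (le_iSup₂ (f := fun (y : ℝ) (_ : 0 < y ∧ y ≤ x) =>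
    ⨆ (a : ℕ) (_ : a.Coprime q),
    ENNReal.ofReal |thetaStar y a q - y / (Nat.totient q : ℝ)|) x ⟨hx, le_rfl⟩)
  exact le_iSup₂ (f := fun (a : ℕ) (_ : a.Coprime q) =>
    ENNReal.ofReal |thetaStar x a q - x / (Nat.totient q : ℝ)|) a ha

lemma abs_sum_primeLog_inResidues_sub_le {W : ℕ} {u : Finset ℕ} {Ω : (p : ℕ) → Finset (ZMod p)}
    (hW : 0 < W) (hu : ∀ p ∈ u, p.Prime ∧ ¬ p ∣ W) {k : ℕ} (hΩ : ∀ p ∈ u, (Ω p).card = k)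
    (h0 : ∀ p ∈ u, (0 : ZMod p) ∉ Ω p) {N : ℕ} (hN : W * ∏ p ∈ u, p ≤ N) :
    |∑ n ∈ Ioc N (2 * N) with InResidues W u Ω n, primeLog n -
      (N : ℝ) / W.totient * ∏ p ∈ u, ((k : ℝ) / (p - 1))| ≤
        (k : ℝ) ^ u.card * (maxError N (W * ∏ p ∈ u, p)).toReal := by
  have hprod : 0 < ∏ p ∈ u, p := prod_pos fun p hp => (hu p hp).1.pos
  have hq : 0 < W * ∏ p ∈ u, p := Nat.mul_pos hW hprod
  have hcard : (residueSystem W u Ω).card = k ^ u.card := by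
    rw [card_residueSystem hW hu, prod_congr rfl hΩ, prod_const]
  have hN0 : (0 : ℝ) < N := by exact_mod_cast hq.trans_le hN
  rw [sum_filter_inResidues hq]
  have e : (N : ℝ) / W.totient * ∏ p ∈ u, ((k : ℝ) / (p - 1)) =
      ∑ r ∈ residueSystem W u Ω, (N : ℝ) / (W * ∏ p ∈ u, p).totient := by
    rw [sum_const, hcard, nsmul_eq_mul, prod_div_distrib, prod_const, totient_mul_prod hu,
      div_mul_div_comm]
    push_cast
    ring
  rw [e, ← sum_sub_distrib]
  refine (abs_sum_le_sum_abs _ _).trans ?_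
  calc _ ≤ ∑ r ∈ residueSystem W u Ω, (maxError N (W * ∏ p ∈ u, p)).toReal := by
        refine sum_le_sum fun r hr => ?_
        have := abs_thetaStar_sub_le hN0 hq (by exact_mod_cast hN)
          (coprime_of_mem_residueSystem (fun p hp => (hu p hp).1) h0 hr)
        have e1 : ⌊2 * (N : ℝ)⌋₊ = 2 * N := by
          rw [← Nat.cast_ofNat, ← Nat.cast_mul, Nat.floor_natCast]
        rwa [thetaStar, Nat.floor_natCast, e1] at this
    _ = _ := by simp [hcard]

/-! ### Second moments of the sieve sum -/

/-- The sieve sum `∑ w s` over the sets `s` of primes with `n mod p ∈ Ω p` for all `p ∈ s`. -/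
noncomputable def sieveSum (P : Finset ℕ) (Ω : (p : ℕ) → Finset (ZMod p)) (w : Finset ℕ → ℝ)
    (n : ℕ) : ℝ :=
  ∑ s ∈ P.powerset with ∀ p ∈ s, (n : ZMod p) ∈ Ω p, w s

lemma sum_mul_sieveSum_sq (P : Finset ℕ) (Ω : (p : ℕ) → Finset (ZMod p)) (w : Finset ℕ → ℝ)
    (W : ℕ) (I : Finset ℕ) (f : ℕ → ℝ) :
    ∑ n ∈ I with n ≡ 1 [MOD W], f n * sieveSum P Ω w n ^ 2 =
      ∑ s ∈ P.powerset, ∑ t ∈ P.powerset, w s * w t *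
        ∑ n ∈ I with InResidues W (s ∪ t) Ω n, f n := by
  have e1 : ∀ n, f n * sieveSum P Ω w n ^ 2 = ∑ s ∈ P.powerset, ∑ t ∈ P.powerset,
      if ∀ p ∈ s ∪ t, (n : ZMod p) ∈ Ω p then w s * w t * f n else 0 := by
    intro n
    rw [sieveSum, sum_filter, sq, sum_mul_sum, mul_sum]
    refine sum_congr rfl fun s _ => ?_
    rw [mul_sum]
    refine sum_congr rfl fun t _ => ?_
    have hiff : (∀ p ∈ s ∪ t, (n : ZMod p) ∈ Ω p) ↔
        (∀ p ∈ s, (n : ZMod p) ∈ Ω p) ∧ ∀ p ∈ t, (n : ZMod p) ∈ Ω p := forall_mem_union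
    by_cases h1 : ∀ p ∈ s, (n : ZMod p) ∈ Ω p <;> by_cases h2 : ∀ p ∈ t, (n : ZMod p) ∈ Ω p
    · rw [if_pos h1, if_pos h2, if_pos (hiff.2 ⟨h1, h2⟩)]
      ring
    · rw [if_neg h2, if_neg fun h => h2 (hiff.1 h).2]
      ring
    · rw [if_neg h1, if_neg fun h => h1 (hiff.1 h).1]
      ring
    · rw [if_neg h1, if_neg fun h => h1 (hiff.1 h).1]
      ring
  rw [sum_congr rfl fun n _ => e1 n, sum_comm]
  refine sum_congr rfl fun s _ => ?_
  rw [sum_comm]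
  refine sum_congr rfl fun t _ => ?_
  rw [mul_sum, ← sum_filter, filter_filter]
  rfl

/-- Replacing the local densities in the sieve quadratic form by approximations. -/
lemma abs_quadraticForm_sub_le {P : Finset ℕ} (hP : ∀ p ∈ P, p.Prime) {w : Finset ℕ → ℝ}
    {R Y X : ℝ} (hY : 0 ≤ Y) (hw : ∀ s ⊆ P, |w s| ≤ 2 ^ s.card * Y)
    (hw0 : ∀ s ⊆ P, R < ∏ p ∈ s, (p : ℝ) → w s = 0) (κ : ℕ → ℝ) (V e : Finset ℕ → ℝ)
    (he : ∀ u ⊆ P, ∏ p ∈ u, (p : ℝ) ≤ R ^ 2 → |V u - X * ∏ p ∈ u, κ p| ≤ e u) :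
    |∑ s ∈ P.powerset, ∑ t ∈ P.powerset, w s * w t * V (s ∪ t) -
      X * ∑ s ∈ P.powerset, ∑ t ∈ P.powerset, w s * w t * ∏ p ∈ s ∪ t, κ p| ≤
    Y ^ 2 * ∑ u ∈ P.powerset.filter (fun u : Finset ℕ => ∏ p ∈ u, (p : ℝ) ≤ R ^ 2), 12 ^ u.card * e u := by
  set G : Finset ℕ → ℝ := fun u => if u ⊆ P ∧ ∏ p ∈ u, (p : ℝ) ≤ R ^ 2 then
    4 ^ u.card * Y ^ 2 * e u else 0 with hG
  have hterm : ∀ s ∈ P.powerset, ∀ t ∈ P.powerset,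
      |w s * w t * V (s ∪ t) - X * (w s * w t * ∏ p ∈ s ∪ t, κ p)| ≤ G (s ∪ t) := by
    intro s hs t ht
    rw [mem_powerset] at hs ht
    have hst := union_subset hs ht
    have e1 : w s * w t * V (s ∪ t) - X * (w s * w t * ∏ p ∈ s ∪ t, κ p) =
        w s * w t * (V (s ∪ t) - X * ∏ p ∈ s ∪ t, κ p) := by ring
    rw [e1, abs_mul, abs_mul]
    by_cases hle : ∏ p ∈ s ∪ t, (p : ℝ) ≤ R ^ 2
    · rw [hG]
      simp only
      rw [if_pos ⟨hst, hle⟩]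
      refine mul_le_mul ?_ (he _ hst hle) (abs_nonneg _) (by positivity)
      have h1 : (2 : ℝ) ^ s.card ≤ 2 ^ (s ∪ t).card :=
        pow_le_pow_right₀ (by norm_num) (card_le_card subset_union_left)
      have h2 : (2 : ℝ) ^ t.card ≤ 2 ^ (s ∪ t).card :=
        pow_le_pow_right₀ (by norm_num) (card_le_card subset_union_right)
      calc |w s| * |w t| ≤ (2 ^ s.card * Y) * (2 ^ t.card * Y) :=
            mul_le_mul (hw s hs) (hw t ht) (abs_nonneg _) (by positivity)
        _ ≤ (2 ^ (s ∪ t).card * Y) * (2 ^ (s ∪ t).card * Y) := by gcongr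
        _ = 4 ^ (s ∪ t).card * Y ^ 2 := by
            rw [show (4 : ℝ) = 2 ^ 2 by norm_num, ← pow_mul]
            ring
    · have hG0 : G (s ∪ t) = 0 := by
        rw [hG]
        simp only
        rw [if_neg fun h => hle h.2]
      rw [hG0]
      have : w s = 0 ∨ w t = 0 := by
        by_contra hne
        rw [not_or] at hne
        have hs' : ∏ p ∈ s, (p : ℝ) ≤ R := not_lt.1 fun h => hne.1 (hw0 s hs h)
        have ht' : ∏ p ∈ t, (p : ℝ) ≤ R := not_lt.1 fun h => hne.2 (hw0 t ht h)
        have h1 := prod_union_le_mul (u := s) (v := t) fun p hp => (hP p (hs hp)).pos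
        have h2 := (Nat.cast_le (α := ℝ)).2 h1
        push_cast at h2
        have h3 : 0 ≤ ∏ p ∈ t, (p : ℝ) := by positivity
        have h4 : 0 ≤ ∏ p ∈ s, (p : ℝ) := by positivity
        refine hle (h2.trans ?_)
        rw [sq]
        exact mul_le_mul hs' ht' h3 (h4.trans hs')
      rcases this with h | h <;> simp [h]
  -- There are `3^|u|` pairs with `s ∪ t = u`; with the factor `4^|u|` from the size of the two
  -- weights this gives `12^|u|`.
  have hsum := sum_powerset_sum_powerset_union P (fun _ => (1 : ℝ)) (fun _ => (1 : ℝ)) G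
  simp only [prod_const_one, one_mul, prod_const] at hsum
  rw [mul_sum, ← sum_sub_distrib]
  refine (abs_sum_le_sum_abs _ _).trans ?_
  calc _ ≤ ∑ s ∈ P.powerset, ∑ t ∈ P.powerset, G (s ∪ t) := by
        refine sum_le_sum fun s hs => ?_
        rw [mul_sum, ← sum_sub_distrib]
        exact (abs_sum_le_sum_abs _ _).trans (sum_le_sum fun t ht => hterm s hs t ht)
    _ = _ := by
        rw [hsum, mul_sum, sum_filter]
        refine sum_congr rfl fun u hu => ?_
        rw [mem_powerset] at hu
        rw [hG]
        simp only [hu, true_and]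
        split_ifs
        · rw [show (1 : ℝ) + 1 + 1 = 3 by norm_num, show (12 : ℝ) = 3 * 4 by norm_num, mul_pow]
          ring
        · simp

lemma sum_pow_card_div_le {P : Finset ℕ} (hP : ∀ p ∈ P, p.Prime) (B : ℕ) {x : ℝ} (hx : 1 ≤ x) :
    ∑ u ∈ P.powerset.filter (fun u : Finset ℕ => ∏ p ∈ u, (p : ℝ) ≤ x), (B : ℝ) ^ u.card / ∏ p ∈ u, (p : ℝ) ≤
      (1 + Real.log x) ^ B := by
  have h := (sum_powerset_le_coprimeSum 1 0 B (P := P)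
    (fun p h => ⟨hP p h, (hP p h).one_lt.not_ge ∘ Nat.le_of_dvd one_pos⟩) x).trans
    (coprimeSum_zero_le 1 B hx)
  refine le_trans ?_ h
  rw [sum_filter]
  refine sum_le_sum fun u hu => ?_
  rw [mem_powerset] at hu
  have hpos : 0 < ∏ p ∈ u, (p : ℝ) := prod_pos fun p hp => by exact_mod_cast (hP p (hu hp)).pos
  split_ifs with hle
  · rw [truncLog_of_one_le ((one_le_div hpos).2 hle), pow_zero, mul_one, prod_div_distrib,
      prod_const]
  · exact mul_nonneg (prod_nonneg fun p _ => by positivity) (truncLog_nonneg _ _)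

lemma sum_pow_card_le {P : Finset ℕ} (hP : ∀ p ∈ P, p.Prime) (B : ℕ) {x : ℝ} (hx : 1 ≤ x) :
    ∑ u ∈ P.powerset.filter (fun u : Finset ℕ => ∏ p ∈ u, (p : ℝ) ≤ x), (B : ℝ) ^ u.card ≤ x * (1 + Real.log x) ^ B := by
  refine le_trans ?_ (mul_le_mul_of_nonneg_left (sum_pow_card_div_le hP B hx) (by linarith))
  rw [mul_sum]
  refine sum_le_sum fun u hu => ?_
  rw [mem_filter, mem_powerset] at hu
  have hpos : 0 < ∏ p ∈ u, (p : ℝ) := prod_pos fun p hp => by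
    exact_mod_cast (hP p (hu.1 hp)).pos
  rw [mul_div_assoc', le_div_iff₀ hpos, mul_comm]
  exact mul_le_mul_of_nonneg_right hu.2 (by positivity)

/-! ### The tuples `n + i W` -/

/-- The residues of `n` modulo `p` for which `p` divides some `n + j W`, `j < k`. -/
def tupleResidues (W k p : ℕ) : Finset (ZMod p) :=
  (range k).image fun j : ℕ => -((j : ZMod p) * W)

/-- The residues of `m = n + i W` modulo `p` for which `p` divides some `n + j W`,
`j < k`, `j ≠ i`. -/
def shiftedResidues (W k i p : ℕ) : Finset (ZMod p) :=
  ((range k).erase i).image fun j : ℕ => ((i : ZMod p) - j) * W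

lemma natCast_mul_injOn {W k p : ℕ} (hp : p.Prime) (hpW : ¬ p ∣ W) (hkp : k ≤ p) {i j : ℕ}
    (hi : i < k) (hj : j < k) (h : (i : ZMod p) * W = j * W) : i = j := by
  have : Fact p.Prime := ⟨hp⟩
  have hW : (W : ZMod p) ≠ 0 := fun h0 => hpW ((ZMod.natCast_eq_zero_iff _ _).1 h0)
  exact Nat.ModEq.eq_of_lt_of_lt ((ZMod.natCast_eq_natCast_iff _ _ _).1 (mul_right_cancel₀ hW h))
    (hi.trans_le hkp) (hj.trans_le hkp)

lemma card_tupleResidues {W k p : ℕ} (hp : p.Prime) (hpW : ¬ p ∣ W) (hkp : k ≤ p) :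
    (tupleResidues W k p).card = k := by
  rw [tupleResidues, card_image_of_injOn, card_range]
  intro i hi j hj hij
  rw [coe_range, Set.mem_Iio] at hi hj
  exact natCast_mul_injOn hp hpW hkp hi hj (neg_injective hij)

lemma card_shiftedResidues {W k p i : ℕ} (hp : p.Prime) (hpW : ¬ p ∣ W) (hkp : k ≤ p)
    (hik : i < k) : (shiftedResidues W k i p).card = k - 1 := by
  rw [shiftedResidues, card_image_of_injOn, card_erase_of_mem (mem_range.2 hik), card_range]
  intro a ha b hb hab
  rw [mem_coe, mem_erase, mem_range] at ha hb
  refine natCast_mul_injOn hp hpW hkp ha.2 hb.2 ?_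
  simp only [sub_mul] at hab
  exact sub_right_injective hab

lemma zero_notMem_shiftedResidues {W k p i : ℕ} (hp : p.Prime) (hpW : ¬ p ∣ W) (hkp : k ≤ p)
    (hik : i < k) : (0 : ZMod p) ∉ shiftedResidues W k i p := by
  intro h
  obtain ⟨j, hj, hj0⟩ := mem_image.1 h
  rw [mem_erase, mem_range] at hj
  rw [sub_mul, sub_eq_zero] at hj0
  exact hj.1 (natCast_mul_injOn hp hpW hkp hik hj.2 hj0).symm

lemma mem_shiftedResidues_iff {W k p i n : ℕ} (hik : i < k)
    (hpn : ¬ p ∣ n + i * W) :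
    ((n + i * W : ℕ) : ZMod p) ∈ shiftedResidues W k i p ↔ (n : ZMod p) ∈ tupleResidues W k p := by
  simp only [shiftedResidues, tupleResidues, mem_image, mem_erase, mem_range]
  constructor
  · rintro ⟨j, ⟨_, hj⟩, h⟩
    refine ⟨j, hj, ?_⟩
    push_cast at h
    linear_combination h
  · rintro ⟨j, hj, h⟩
    refine ⟨j, ⟨?_, hj⟩, ?_⟩
    · rintro rfl
      refine hpn ((ZMod.natCast_eq_zero_iff _ _).1 ?_)
      push_cast
      linear_combination -h
    · push_cast
      linear_combination h

/-- Substitute `m = n + i W`. A prime `m > N` is divisible by no `p ∈ P`, since `p ≤ N`; so the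
class `j = i` never occurs and may be dropped, leaving `k - 1` classes. The range of `n` is extended
down by `k W` to serve all `i` at once. -/
lemma sum_primeLog_sieveSum_eq {W k i N : ℕ} (hik : i < k) (hN : k * W ≤ N) {P : Finset ℕ}
    (hP : ∀ p ∈ P, p.Prime ∧ p ≤ N) (w : Finset ℕ → ℝ) :
    ∑ m ∈ Ioc N (2 * N) with m ≡ 1 [MOD W],
      primeLog m * sieveSum P (shiftedResidues W k i) w m ^ 2 =
    ∑ n ∈ Ioc (N - k * W) (2 * N) with n ≡ 1 [MOD W],
      (if N < n + i * W ∧ n + i * W ≤ 2 * N then primeLog (n + i * W) else 0) *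
        sieveSum P (tupleResidues W k) w n ^ 2 := by
  have hiW : i * W ≤ k * W := Nat.mul_le_mul_right _ hik.le
  have hval : ∀ n, N < n + i * W →
      primeLog (n + i * W) * sieveSum P (shiftedResidues W k i) w (n + i * W) ^ 2 =
      primeLog (n + i * W) * sieveSum P (tupleResidues W k) w n ^ 2 := by
    intro n hn
    by_cases hpr : (n + i * W).Prime
    · congr 2
      unfold sieveSum
      refine sum_congr (filter_congr fun s hs => forall₂_congr fun p hp => ?_) fun _ _ => rfl
      have hpP := hP p (mem_powerset.1 hs hp)
      refine mem_shiftedResidues_iff hik fun hd => ?_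
      rcases (Nat.dvd_prime hpr).1 hd with h | h
      · exact hpP.1.one_lt.ne' h
      · omega
    · rw [primeLog, if_neg hpr, zero_mul, zero_mul]
  simp only [ite_mul, zero_mul]
  rw [← sum_filter, filter_filter]
  refine sum_nbij' (fun m => m - i * W) (fun n => n + i * W) ?_ ?_ ?_ ?_ ?_
  · intro m hm
    rw [mem_filter, mem_Ioc] at hm ⊢
    have e : m - i * W + i * W = m := by omega
    rw [e]
    refine ⟨by omega, ?_, hm.1⟩
    have h1 : m - i * W + i * W ≡ 1 [MOD W] := by rw [e]; exact hm.2
    have h2 : m - i * W ≡ m - i * W + i * W [MOD W] := by simp [Nat.ModEq]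
    exact h2.trans h1
  · intro n hn
    rw [mem_filter, mem_Ioc] at hn ⊢
    refine ⟨hn.2.2, ?_⟩
    have h2 : n ≡ n + i * W [MOD W] := by simp [Nat.ModEq]
    exact h2.symm.trans hn.2.1
  · intro m hm
    rw [mem_filter, mem_Ioc] at hm
    omega
  · intro n hn
    omega
  · intro m hm
    rw [mem_filter, mem_Ioc] at hm
    have e : m - i * W + i * W = m := by omega
    have := hval (m - i * W) (by omega)
    rw [e] at this ⊢
    exact this

/-- For each `n` at most one `i` contributes, and it contributes at most `log(2N)`. -/
lemma sum_primeLog_sieveSum_le {W k N : ℕ} (hN : k * W ≤ N) (hN1 : 1 ≤ N) {P : Finset ℕ}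
    (hP : ∀ p ∈ P, p.Prime ∧ p ≤ N) (w : Finset ℕ → ℝ)
    (hone : ∀ n, N - k * W < n → ∀ i < k, ∀ j < k, (n + i * W).Prime → (n + j * W).Prime → i = j) :
    ∑ i ∈ range k, ∑ m ∈ Ioc N (2 * N) with m ≡ 1 [MOD W],
      primeLog m * sieveSum P (shiftedResidues W k i) w m ^ 2 ≤
    Real.log (2 * N) * ∑ n ∈ Ioc (N - k * W) (2 * N) with n ≡ 1 [MOD W],
      1 * sieveSum P (tupleResidues W k) w n ^ 2 := by
  rw [sum_congr rfl fun i hi => sum_primeLog_sieveSum_eq (mem_range.1 hi) hN hP w, sum_comm,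
    mul_sum]
  have hN' : (1 : ℝ) ≤ N := by exact_mod_cast hN1
  have hlog : 0 ≤ Real.log (2 * N) := Real.log_nonneg (by linarith)
  refine sum_le_sum fun n hn => ?_
  rw [← sum_mul, one_mul]
  refine mul_le_mul_of_nonneg_right ?_ (sq_nonneg _)
  have hn' : N - k * W < n := (mem_Ioc.1 (mem_filter.1 hn).1).1
  by_cases hex : ∃ i < k, (n + i * W).Prime
  · obtain ⟨i, hi, hpr⟩ := hex
    rw [sum_eq_single i]
    · split_ifs with h
      · exact primeLog_le (by exact_mod_cast h.2) (by linarith)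
      · exact hlog
    · intro j hj hji
      have : ¬ (n + j * W).Prime := fun h => hji (hone n hn' j (mem_range.1 hj) i hi h hpr)
      rw [primeLog, if_neg this, ite_self]
    · intro h
      exact absurd (mem_range.2 hi) h
  · refine le_trans (le_of_eq (sum_eq_zero fun i hi => ?_)) hlog
    have : ¬ (n + i * W).Prime := fun h => hex ⟨i, mem_range.1 hi, h⟩
    rw [primeLog, if_neg this, ite_self]

/-! ### Error terms on average and the sieve inequality -/

/-- Cauchy-Schwarz with the trivial bound: a divisor-weighted sum of `maxError`. -/
lemma sum_pow_card_mul_maxError_le {W N : ℕ} (hW : 0 < W) {P : Finset ℕ}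
    (hP : ∀ p ∈ P, p.Prime ∧ ¬ p ∣ W) {R θ E : ℝ} (hR : 1 ≤ R) (hθ : θ ≤ 1) (hN : 1 ≤ N)
    (hWR : W * R ^ 2 ≤ (N : ℝ) ^ θ) (hE : 0 ≤ E)
    (hlevel : ∑ q ∈ Icc 1 ⌊(N : ℝ) ^ θ⌋₊, maxError N q ≤ ENNReal.ofReal E) (B : ℕ) :
    ∑ u ∈ P.powerset.filter (fun u : Finset ℕ => ∏ p ∈ u, (p : ℝ) ≤ R ^ 2),
      (B : ℝ) ^ u.card * (maxError N (W * ∏ p ∈ u, p)).toReal ≤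
    √(N * (3 * Real.log (2 * N) + 1) * (1 + Real.log N) ^ (2 * B ^ 2) * E) := by
  set U := P.powerset.filter (fun u : Finset ℕ => ∏ p ∈ u, (p : ℝ) ≤ R ^ 2) with hU
  set e : Finset ℕ → ℝ := fun u => (maxError N (W * ∏ p ∈ u, p)).toReal with he
  have hN' : (1 : ℝ) ≤ N := by exact_mod_cast hN
  have hW1 : (1 : ℝ) ≤ W := by exact_mod_cast hW
  have hlogN : 0 ≤ Real.log N := Real.log_nonneg hN'
  have hlog2N : 0 ≤ Real.log (2 * N) := Real.log_nonneg (by linarith)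
  have hUP : ∀ u ∈ U, ∀ p ∈ u, p.Prime ∧ ¬ p ∣ W := fun u hu p hp =>
    hP p (mem_powerset.1 (mem_filter.1 hu).1 hp)
  have hpos : ∀ u ∈ U, 0 < ∏ p ∈ u, p := fun u hu => prod_pos fun p hp => (hUP u hu p hp).1.pos
  have hq0 : ∀ u ∈ U, 0 < W * ∏ p ∈ u, p := fun u hu => Nat.mul_pos hW (hpos u hu)
  have hqθ : ∀ u ∈ U, ((W * ∏ p ∈ u, p : ℕ) : ℝ) ≤ (N : ℝ) ^ θ := by
    intro u hu
    push_cast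
    refine le_trans ?_ hWR
    have := (mem_filter.1 hu).2
    gcongr
  have hNθ : (N : ℝ) ^ θ ≤ N := by
    calc (N : ℝ) ^ θ ≤ (N : ℝ) ^ (1 : ℝ) := Real.rpow_le_rpow_of_exponent_le hN' hθ
      _ = N := Real.rpow_one _
  have hR2N : R ^ 2 ≤ N := by nlinarith [sq_nonneg R]
  have hetop : ∀ u ∈ U, maxError N (W * ∏ p ∈ u, p) ≠ ⊤ := fun u hu =>
    ne_top_of_le_ne_top ENNReal.ofReal_ne_top (maxError_le (hq0 u hu) ((hqθ u hu).trans hNθ))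
  have he0 : ∀ u, 0 ≤ e u := fun u => ENNReal.toReal_nonneg
  have hebound : ∀ u ∈ U, e u ≤ N * (3 * Real.log (2 * N) + 1) *
      ((2 : ℝ) ^ u.card / ∏ p ∈ u, (p : ℝ)) := by
    intro u hu
    have hbd := (ENNReal.toReal_mono ENNReal.ofReal_ne_top
      (maxError_le (hq0 u hu) ((hqθ u hu).trans hNθ)))
    have hprod1 : (1 : ℝ) ≤ ∏ p ∈ u, (p : ℝ) :=
      one_le_prod fun p hp => by exact_mod_cast (hUP u hu p hp).1.one_lt.le
    rw [ENNReal.toReal_ofReal (by positivity)] at hbd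
    refine hbd.trans ?_
    have h2 : (1 : ℝ) ≤ 2 ^ u.card := one_le_pow₀ (by norm_num)
    have h3 : 3 * (N : ℝ) / (W * ∏ p ∈ u, p : ℕ) ≤ 3 * N * (2 ^ u.card / ∏ p ∈ u, (p : ℝ)) := by
      push_cast
      rw [mul_div_assoc']
      refine div_le_div₀ (by positivity) (le_mul_of_one_le_right (by positivity) h2)
        (by positivity) ?_
      exact le_mul_of_one_le_left (by positivity) hW1
    have h4 : (N : ℝ) / (W * ∏ p ∈ u, p).totient ≤ N * (2 ^ u.card / ∏ p ∈ u, (p : ℝ)) := by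
      rw [totient_mul_prod (hUP u hu), mul_div_assoc']
      have hφ : (1 : ℝ) ≤ W.totient := by exact_mod_cast Nat.totient_pos.2 hW
      -- Since `p ≤ 2(p-1)`, replacing the totient by the modulus costs `2^|u|`.
      have h5 : ∏ p ∈ u, (p : ℝ) ≤ 2 ^ u.card * ∏ p ∈ u, ((p : ℝ) - 1) := by
        rw [← prod_const, ← prod_mul_distrib]
        refine prod_le_prod (fun p _ => by positivity) fun p hp => ?_
        have : (2 : ℝ) ≤ p := by exact_mod_cast (hUP u hu p hp).1.two_le
        linarith
      have h6 : 0 < ∏ p ∈ u, ((p : ℝ) - 1) := prod_pos fun p hp => by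
        have : (2 : ℝ) ≤ p := by exact_mod_cast (hUP u hu p hp).1.two_le
        linarith
      rw [div_le_div_iff₀ (by positivity) (by positivity)]
      calc (N : ℝ) * ∏ p ∈ u, (p : ℝ) ≤ N * (1 * (2 ^ u.card * ∏ p ∈ u, ((p : ℝ) - 1))) := by
            rw [one_mul]
            gcongr
        _ ≤ N * (W.totient * (2 ^ u.card * ∏ p ∈ u, ((p : ℝ) - 1))) := by gcongr
        _ = _ := by ring
    calc _ ≤ 3 * N * (2 ^ u.card / ∏ p ∈ u, (p : ℝ)) * Real.log (2 * N) +
          N * (2 ^ u.card / ∏ p ∈ u, (p : ℝ)) := by gcongr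
      _ = _ := by ring
  -- Split `B^|u| e` as `B^|u| √e · √e`. The first factor is handled by the trivial bound, where
  -- `B²` and the above `2^|u|` combine to `(2B²)^|u|`; the second by the level of distribution.
  have hcs : (∑ u ∈ U, (B : ℝ) ^ u.card * e u) ^ 2 ≤
      (∑ u ∈ U, ((B : ℝ) ^ 2) ^ u.card * e u) * ∑ u ∈ U, e u := by
    refine sum_sq_le_sum_mul_sum_of_sq_le_mul U (fun u _ => mul_nonneg (by positivity) (he0 u))
      (fun u _ => he0 u) fun u _ => le_of_eq ?_
    rw [← pow_mul, mul_comm 2 u.card, pow_mul]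
    ring
  have hsum1 : ∑ u ∈ U, ((B : ℝ) ^ 2) ^ u.card * e u ≤
      N * (3 * Real.log (2 * N) + 1) * (1 + Real.log N) ^ (2 * B ^ 2) := by
    calc _ ≤ ∑ u ∈ U, N * (3 * Real.log (2 * N) + 1) *
          (((2 * B ^ 2 : ℕ) : ℝ) ^ u.card / ∏ p ∈ u, (p : ℝ)) := by
          refine sum_le_sum fun u hu => ?_
          refine (mul_le_mul_of_nonneg_left (hebound u hu) (by positivity)).trans (le_of_eq ?_)
          push_cast
          rw [mul_pow (2 : ℝ)]
          ring
      _ ≤ N * (3 * Real.log (2 * N) + 1) * (1 + Real.log (R ^ 2)) ^ (2 * B ^ 2) := by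
          rw [← mul_sum]
          refine mul_le_mul_of_nonneg_left ?_ (by positivity)
          exact sum_pow_card_div_le (fun p hp => (hP p hp).1) (2 * B ^ 2) (one_le_pow₀ hR)
      _ ≤ _ := by
          have h1 : 0 ≤ Real.log (R ^ 2) := Real.log_nonneg (one_le_pow₀ hR)
          have h2 : Real.log (R ^ 2) ≤ Real.log N := Real.log_le_log (by positivity) hR2N
          gcongr
  have hsum2 : ∑ u ∈ U, e u ≤ E := by
    have h1 : ∑ u ∈ U, maxError N (W * ∏ p ∈ u, p) ≤
        ∑ q ∈ Icc 1 ⌊(N : ℝ) ^ θ⌋₊, maxError N q := by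
      have hinj : Set.InjOn (fun u : Finset ℕ => W * ∏ p ∈ u, p) U := by
        intro a ha b hb hab
        have h2 : ∏ p ∈ a, p = ∏ p ∈ b, p := Nat.eq_of_mul_eq_mul_left hW hab
        exact prod_primes_injOn (fun p hp => (hP p hp).1) (mem_coe.2 (mem_filter.1 ha).1)
          (mem_coe.2 (mem_filter.1 hb).1) h2
      rw [← sum_image (f := fun q => maxError N q) hinj]
      refine sum_le_sum_of_subset fun q hq => ?_
      obtain ⟨u, hu, rfl⟩ := mem_image.1 hq
      rw [mem_Icc]
      exact ⟨hq0 u hu, Nat.le_floor (hqθ u hu)⟩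
    have h2 := ENNReal.toReal_mono ENNReal.ofReal_ne_top (h1.trans hlevel)
    rwa [ENNReal.toReal_sum hetop, ENNReal.toReal_ofReal hE] at h2
  refine Real.le_sqrt_of_sq_le (hcs.trans ?_)
  exact mul_le_mul hsum1 hsum2 (sum_nonneg fun u _ => he0 u) (by positivity)

/-- The inequality that holds when every tuple contains at most one prime. -/
lemma sieve_inequality {k D l N : ℕ} {R θ E : ℝ} (hk : 2 ≤ k) (hkD : 2 * k ≤ D)
    (hR : 1 ≤ R) (hRN : R ≤ N) (hkN : k * D.factorial ≤ N) (hθ : θ ≤ 1)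
    (hWR : D.factorial * R ^ 2 ≤ (N : ℝ) ^ θ) (hE : 0 ≤ E)
    (hlevel : ∑ q ∈ Icc 1 ⌊(N : ℝ) ^ θ⌋₊, maxError N q ≤ ENNReal.ofReal E)
    (hone : ∀ n, N - k * D.factorial < n → ∀ i < k, ∀ j < k,
      (n + i * D.factorial).Prime → (n + j * D.factorial).Prime → i = j) :
    (k : ℝ) * ((N : ℝ) / D.factorial.totient *
        (((D.factorial.totient : ℝ) / D.factorial / (l + 1)) ^ 2 *
          coprimeSum D.factorial (2 * (l + 1)) (k - 1) R) -
        ((1 + Real.log R) ^ (l + 2 * k)) ^ 2 *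
          √(N * (3 * Real.log (2 * N) + 1) *
            (1 + Real.log N) ^ (2 * (12 * (k - 1)) ^ 2) * E)) ≤
      Real.log (2 * N) * (((N : ℝ) + k * D.factorial) / D.factorial *
        (Real.exp (2 * k ^ 2 / D) * coprimeSum D.factorial (2 * l) k R) +
        ((1 + Real.log R) ^ (l + 2 * k)) ^ 2 *
          (R ^ 2 * (1 + Real.log (R ^ 2)) ^ (12 * k))) := by
  set W := D.factorial with hWdef
  have hW : 0 < W := Nat.factorial_pos D
  have hW' : (0 : ℝ) < W := by exact_mod_cast hW
  have hφ : (0 : ℝ) < W.totient := by exact_mod_cast Nat.totient_pos.2 hW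
  have hN1 : 1 ≤ N := (Nat.mul_pos (by omega) hW).trans_le hkN
  have hlog2N : 0 ≤ Real.log (2 * N) := by
    have : (1 : ℝ) ≤ N := by exact_mod_cast hN1
    exact Real.log_nonneg (by linarith)
  set P := (range (⌊R⌋₊ + 1)).filter fun p => p.Prime ∧ ¬ p ∣ W with hPdef
  have hP : ∀ p : ℕ, p ∈ P ↔ p.Prime ∧ (p : ℝ) ≤ R ∧ ¬ p ∣ W := by
    intro p
    rw [hPdef, mem_filter, mem_range, Nat.lt_succ_iff, Nat.le_floor_iff (by linarith)]
    tauto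
  have hPpr : ∀ p ∈ P, p.Prime := fun p hp => ((hP p).1 hp).1
  have hPW : ∀ p ∈ P, p.Prime ∧ ¬ p ∣ W := fun p hp => ⟨hPpr p hp, ((hP p).1 hp).2.2⟩
  -- A prime not dividing `D!` exceeds `D`, hence `2k`; this makes the local densities harmless.
  have hPD : ∀ p ∈ P, D < p := fun p hp => by
    have h := (hPW p hp).2
    rw [hWdef, (hPpr p hp).dvd_factorial] at h
    omega
  have hPN : ∀ p ∈ P, p.Prime ∧ p ≤ N := fun p hp =>
    ⟨hPpr p hp, by exact_mod_cast (((hP p).1 hp).2.1).trans hRN⟩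
  have hkP : ∀ p ∈ P, k ≤ p := fun p hp => by
    have := hPD p hp
    omega
  set w := sieveWeight P k (fun v => truncLog l (R / ∏ p ∈ v, (p : ℝ))) with hw
  set Y := (1 + Real.log R) ^ (l + 2 * k) with hY
  have hlogR := Real.log_nonneg hR
  have hY0 : 0 ≤ Y := by positivity
  have hwb : ∀ s ⊆ P, |w s| ≤ 2 ^ s.card * Y := fun s hs =>
    abs_sieveWeight_le (by omega) l hR (fun p hp => ⟨hPpr p hp, by have := hPD p hp; omega⟩) hs
  have hw0 : ∀ s ⊆ P, R < ∏ p ∈ s, (p : ℝ) → w s = 0 := fun s _ h =>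
    sieveWeight_eq_zero (by linarith) hPpr h
  have hNθ : (N : ℝ) ^ θ ≤ N := by
    calc (N : ℝ) ^ θ ≤ (N : ℝ) ^ (1 : ℝ) :=
          Real.rpow_le_rpow_of_exponent_le (by exact_mod_cast hN1) hθ
      _ = N := Real.rpow_one _
  have hS1 : ∑ n ∈ Ioc (N - k * W) (2 * N) with n ≡ 1 [MOD W],
      1 * sieveSum P (tupleResidues W k) w n ^ 2 ≤
      ((N : ℝ) + k * W) / W * (Real.exp (2 * k ^ 2 / D) * coprimeSum W (2 * l) k R) +
        Y ^ 2 * (R ^ 2 * (1 + Real.log (R ^ 2)) ^ (12 * k)) := by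
    rw [sum_mul_sieveSum_sq P (tupleResidues W k) w W (Ioc (N - k * W) (2 * N)) (fun _ => 1)]
    have h1 := abs_quadraticForm_sub_le hPpr (X := ((N : ℝ) + k * W) / W) hY0 hwb hw0
      (fun p => (k : ℝ) / p)
      (fun u => ∑ n ∈ Ioc (N - k * W) (2 * N) with InResidues W u (tupleResidues W k) n, (1 : ℝ))
      (fun u => (k : ℝ) ^ u.card) (fun u hu _ => by
        have h := abs_card_inResidues_sub_le hW (u := u) (Ω := tupleResidues W k)
          (fun p hp => hPW p (hu hp)) (k := k)
          (fun p hp => card_tupleResidues (hPpr p (hu hp)) (hPW p (hu hp)).2 (hkP p (hu hp)))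
          (a := N - k * W) (b := 2 * N) (by omega)
        have e : ((2 * N : ℕ) : ℝ) - (N - k * W : ℕ) = N + k * W := by
          rw [Nat.cast_sub hkN]
          push_cast
          ring
        rwa [e] at h)
    have h2 := sub_le_iff_le_add.1 ((abs_le.1 h1).2)
    refine h2.trans ?_
    rw [add_comm]
    refine add_le_add ?_ ?_
    · refine mul_le_mul_of_nonneg_left ?_ (by positivity)
      exact quadraticForm_le (by omega) (by omega) hkD l (by linarith)
        (fun p hp => ⟨hPpr p hp, (hPW p hp).2, hPD p hp⟩)
    · refine mul_le_mul_of_nonneg_left ?_ (by positivity)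
      refine le_trans (le_of_eq ?_) (sum_pow_card_le hPpr (12 * k) (one_le_pow₀ hR))
      refine sum_congr rfl fun u _ => ?_
      push_cast
      rw [mul_pow]
  have hS2 : ∀ i ∈ range k, (N : ℝ) / W.totient *
        (((W.totient : ℝ) / W / (l + 1)) ^ 2 * coprimeSum W (2 * (l + 1)) (k - 1) R) -
        Y ^ 2 * √(N * (3 * Real.log (2 * N) + 1) *
            (1 + Real.log N) ^ (2 * (12 * (k - 1)) ^ 2) * E) ≤
      ∑ m ∈ Ioc N (2 * N) with m ≡ 1 [MOD W],
        primeLog m * sieveSum P (shiftedResidues W k i) w m ^ 2 := by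
    intro i hi
    rw [mem_range] at hi
    rw [sum_mul_sieveSum_sq]
    have h1 := abs_quadraticForm_sub_le hPpr (X := (N : ℝ) / W.totient) hY0 hwb hw0
      (fun p => ((k - 1 : ℕ) : ℝ) / (p - 1))
      (fun u => ∑ n ∈ Ioc N (2 * N) with InResidues W u (shiftedResidues W k i) n, primeLog n)
      (fun u => ((k - 1 : ℕ) : ℝ) ^ u.card * (maxError N (W * ∏ p ∈ u, p)).toReal)
      (fun u hu huR => by
        refine abs_sum_primeLog_inResidues_sub_le hW (fun p hp => hPW p (hu hp)) (k := k - 1)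
          (fun p hp => card_shiftedResidues (hPpr p (hu hp)) (hPW p (hu hp)).2 (hkP p (hu hp)) hi)
          (fun p hp => zero_notMem_shiftedResidues (hPpr p (hu hp)) (hPW p (hu hp)).2
            (hkP p (hu hp)) hi) ?_
        have h3 : ((W * ∏ p ∈ u, p : ℕ) : ℝ) ≤ N := by
          push_cast
          refine le_trans ?_ (hWR.trans hNθ)
          gcongr
        exact_mod_cast h3)
    have h2 := (abs_le.1 h1).1
    have hk1 : ((k - 1 : ℕ) : ℝ) = k - 1 := by
      rw [Nat.cast_sub (by omega)]
      simp
    have h3 := quadraticForm_prime_ge hW hk l (by linarith : 0 < R) hP fun p hp => by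
      have := hPD p hp
      omega
    have h4 : (N : ℝ) / W.totient *
        (((W.totient : ℝ) / W / (l + 1)) ^ 2 * coprimeSum W (2 * (l + 1)) (k - 1) R) ≤
        (N : ℝ) / W.totient * ∑ s ∈ P.powerset, ∑ t ∈ P.powerset, w s * w t *
          ∏ p ∈ s ∪ t, (((k - 1 : ℕ) : ℝ) / (p - 1)) := by
      rw [hk1]
      exact mul_le_mul_of_nonneg_left h3 (by positivity)
    have h5 := sum_pow_card_mul_maxError_le hW hPW hR hθ hN1 hWR hE hlevel (12 * (k - 1))
    have h6 : Y ^ 2 * ∑ u ∈ P.powerset.filter (fun u : Finset ℕ => ∏ p ∈ u, (p : ℝ) ≤ R ^ 2),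
        12 ^ u.card * (((k - 1 : ℕ) : ℝ) ^ u.card * (maxError N (W * ∏ p ∈ u, p)).toReal) ≤
        Y ^ 2 * √(N * (3 * Real.log (2 * N) + 1) *
            (1 + Real.log N) ^ (2 * (12 * (k - 1)) ^ 2) * E) := by
      refine mul_le_mul_of_nonneg_left (le_trans (le_of_eq ?_) h5) (by positivity)
      refine sum_congr rfl fun u _ => ?_
      push_cast
      rw [mul_pow, mul_assoc]
    linarith
  have hmain := sum_primeLog_sieveSum_le hkN hN1 hPN w hone
  have hsum := sum_le_sum hS2
  rw [sum_const, card_range, nsmul_eq_mul] at hsum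
  exact hsum.trans (hmain.trans (mul_le_mul_of_nonneg_left hS1 hlog2N))

/-! ### Comparison of main terms and choice of parameters -/

/-- To be used with `X = log N`: the factor `X + 1` bounds `log(2N)`, and `1 + 1/X` bounds the
lengthening of the range of `n` by `k W`. Their product is at most `X + 3`, so every term other than
the leading ones is absorbed by a multiple of `X^(n+1)`. -/
lemma mul_pow_lt_of_lt {a b C₁ C₂ C₃ X : ℝ} (n : ℕ) (hb : 0 ≤ b) (hC₁ : 0 ≤ C₁)
    (hC₃ : 0 ≤ C₃) (hX : 1 ≤ X) (h : C₂ + C₃ + 3 * b + 4 * C₁ + 2 < (a - b) * X) :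
    (X + 1) * ((1 + 1 / X) * (b * X ^ (n + 1) + C₁ * X ^ n) + 1) <
      a * X ^ (n + 2) - C₂ * X ^ (n + 1) - C₃ := by
  have hX0 : 0 < X := by linarith
  have hp : 0 < X ^ n := by positivity
  have hp1 : 1 ≤ X ^ n := one_le_pow₀ hX
  have h1 : (X + 1) * (1 + 1 / X) ≤ X + 3 := by
    have e : (X + 1) * (1 + 1 / X) = (X + 1) ^ 2 / X := by field_simp
    rw [e, div_le_iff₀ hX0]
    nlinarith
  have h2 : 0 ≤ b * X ^ (n + 1) + C₁ * X ^ n := by positivity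
  have h3 := mul_le_mul_of_nonneg_right h1 h2
  have h4 : X ^ n * 1 ≤ X ^ n * X := by gcongr
  have h5 := mul_lt_mul_of_pos_right h (mul_pos hp hX0)
  have h6 : C₁ * X ^ n ≤ C₁ * (X ^ n * X) := by
    refine mul_le_mul_of_nonneg_left ?_ hC₁
    linarith
  have h7 : X * 1 ≤ X * X ^ n := by gcongr
  have h8 : C₃ * 1 ≤ C₃ * (X * X ^ n) := by
    refine mul_le_mul_of_nonneg_left ?_ hC₃
    nlinarith
  have e : (X + 1) * ((1 + 1 / X) * (b * X ^ (n + 1) + C₁ * X ^ n) + 1) =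
      (X + 1) * (1 + 1 / X) * (b * X ^ (n + 1) + C₁ * X ^ n) + (X + 1) := by ring
  rw [e]
  have e2 : (X + 3) * (b * X ^ (n + 1) + C₁ * X ^ n) =
      b * (X ^ n * X) * X + C₁ * (X ^ n * X) + 3 * b * (X ^ n * X) + 3 * (C₁ * X ^ n) := by ring
  rw [e2] at h3
  have e3 : a * X ^ (n + 2) = a * (X ^ n * X) * X := by ring
  have e4 : C₂ * X ^ (n + 1) = C₂ * (X ^ n * X) := by ring
  rw [e3, e4]
  nlinarith

/-- The comparison of main terms, for `k = (2 l + 1) ^ 2` and `c = φ(W) / W`. -/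
lemma main_term_lt {l m : ℕ} (hm : m + 2 = (2 * l + 1) ^ 2) {φ W lam e : ℝ} (hφ : 0 < φ)
    (hW : 0 < W) (hlam : 0 < lam) (he : e < lam * ((2 * l + 1) / (l + 1)) ^ 2) :
    1 / W * e * ((φ / W) ^ (m + 1 + 1) * ((2 * l).factorial / (2 * l + (m + 1) + 1).factorial)) *
        lam ^ (2 * l + m + 2) <
      (m + 2 : ℕ) * (1 / φ * (φ / W / (l + 1)) ^ 2 * ((φ / W) ^ (m + 1) *
        ((2 * (l + 1)).factorial / (2 * (l + 1) + m + 1).factorial)) * lam ^ (2 * l + m + 3)) := by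
  -- The choice of `k = m + 2` makes `2l + 1 + k = (2l+1)(2l+2)`, so the two factorial quotients
  -- agree exactly.
  have h1 : ((2 * (l + 1)).factorial : ℝ) / (2 * (l + 1) + m + 1).factorial =
      (2 * l).factorial / (2 * l + (m + 1) + 1).factorial := by
    have e1 : 2 * (l + 1) = 2 * l + 1 + 1 := by ring
    have e2 : 2 * (l + 1) + m + 1 = (2 * l + (m + 1) + 1) + 1 := by ring
    have e3 : 2 * l + (m + 1) + 1 + 1 = (2 * l + 1) * (2 * l + 1 + 1) := by
      have : 2 * l + (m + 1) + 1 + 1 = 2 * l + 1 + (m + 2) := by ring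
      rw [this, hm]
      ring
    rw [e2, Nat.factorial_succ (2 * l + (m + 1) + 1), e1, Nat.factorial_succ (2 * l + 1),
      Nat.factorial_succ (2 * l), e3]
    have h2 : ((2 * l + (m + 1) + 1).factorial : ℝ) ≠ 0 := by positivity
    push_cast
    field_simp
  have hkr : ((m + 2 : ℕ) : ℝ) = (2 * l + 1) ^ 2 := by
    rw [hm]
    push_cast
    ring
  have h2 : 1 / φ * (φ / W / (l + 1)) ^ 2 = 1 / W * (φ / W) / (l + 1) ^ 2 := by
    field_simp
  rw [h1, hkr, h2]
  set f : ℝ := (2 * l).factorial / (2 * l + (m + 1) + 1).factorial with hf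
  have hf0 : 0 < f := by positivity
  set c := φ / W with hc
  have hc0 : 0 < c := by positivity
  calc 1 / W * e * (c ^ (m + 1 + 1) * f) * lam ^ (2 * l + m + 2)
      = e * (1 / W * c ^ (m + 1 + 1) * f * lam ^ (2 * l + m + 2)) := by ring
    _ < lam * ((2 * l + 1) / (l + 1)) ^ 2 *
        (1 / W * c ^ (m + 1 + 1) * f * lam ^ (2 * l + m + 2)) :=
        mul_lt_mul_of_pos_right he (by positivity)
    _ = _ := by
        rw [div_pow]
        ring

lemma exists_sieve_parameters {τ : ℝ} (hτ : 1 / 2 < τ) :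
    ∃ l m D : ℕ, m + 2 = (2 * l + 1) ^ 2 ∧ 2 * (m + 2) ≤ D ∧
      Real.exp (2 * ((m + 2 : ℕ) : ℝ) ^ 2 / D) < τ / 2 * ((2 * l + 1) / (l + 1)) ^ 2 := by
  have hε : 0 < 1 - 1 / (2 * τ) := by
    have : 1 / (2 * τ) < 1 := by
      rw [div_lt_one (by linarith)]
      linarith
    linarith
  obtain ⟨l, hl⟩ := exists_nat_one_div_lt hε
  have hl1 : 1 ≤ l := by
    rcases Nat.eq_zero_or_pos l with h | h
    · subst h
      have : 0 < 1 / (2 * τ) := by positivity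
      simp only [Nat.cast_zero, zero_add, div_one] at hl
      linarith
    · exact h
  have hρ : 1 < τ / 2 * ((2 * (l : ℝ) + 1) / (l + 1)) ^ 2 := by
    set δ : ℝ := 1 / ((l : ℝ) + 1) with hδ
    have e : (2 * (l : ℝ) + 1) / (l + 1) = 2 - δ := by
      rw [hδ]
      field_simp
      ring
    rw [e]
    -- As `(2-δ)² ≥ 4(1-δ)`, the ratio is at least `2τ(1-δ) > 1`. A large `D` then brings the
    -- exponential below it.
    have h1 : 1 / (2 * τ) < 1 - δ := by linarith
    rw [div_lt_iff₀ (by linarith)] at h1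
    nlinarith [mul_nonneg (show (0 : ℝ) ≤ τ by linarith) (sq_nonneg δ)]
  obtain ⟨m, hm⟩ : ∃ m, m + 2 = (2 * l + 1) ^ 2 := by
    refine ⟨(2 * l + 1) ^ 2 - 2, ?_⟩
    have : 2 ≤ (2 * l + 1) ^ 2 := by nlinarith
    omega
  set ρ := τ / 2 * ((2 * (l : ℝ) + 1) / (l + 1)) ^ 2 with hρdef
  have hlogρ : 0 < Real.log ρ := Real.log_pos hρ
  obtain ⟨D, hD⟩ := exists_nat_gt (2 * ((m + 2 : ℕ) : ℝ) ^ 2 / Real.log ρ + 2 * ((m + 2 : ℕ) : ℝ))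
  refine ⟨l, m, D, hm, ?_, ?_⟩
  · have h1 : 0 ≤ 2 * ((m + 2 : ℕ) : ℝ) ^ 2 / Real.log ρ := by positivity
    have h2 : 2 * ((m + 2 : ℕ) : ℝ) < D := by linarith
    have h3 : 2 * (m + 2) < D := by exact_mod_cast h2
    exact h3.le
  · rw [← Real.lt_log_iff_exp_lt (by linarith)]
    have h1 : 2 * ((m + 2 : ℕ) : ℝ) ^ 2 / Real.log ρ < D := by
      have : 0 ≤ 2 * ((m + 2 : ℕ) : ℝ) := by positivity
      linarith
    have hD0 : (0 : ℝ) < D := lt_of_le_of_lt (by positivity) h1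
    rw [div_lt_iff₀ hlogρ] at h1
    rw [div_lt_iff₀ hD0]
    linarith

/-- Because `R² = N^τ` with `τ < 1` in the application, a power of `N` is left over to absorb the
logarithms. -/
lemma counting_error_le {N X L R τ : ℝ} {M B : ℕ} (hX : 1 ≤ X)
    (hL0 : 0 ≤ L) (hLX : 1 + L ≤ 2 * X) (hR0 : 0 ≤ Real.log (R ^ 2))
    (hRX : 1 + Real.log (R ^ 2) ≤ 2 * X)
    (hR : R ^ 2 = N ^ τ) (hN : 1 ≤ N) (h : (2 * X) ^ (2 * M + B) ≤ N ^ (1 - τ)) :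
    ((1 + L) ^ M) ^ 2 * (R ^ 2 * (1 + Real.log (R ^ 2)) ^ B) ≤ N := by
  have hN0 : 0 < N := by linarith
  calc ((1 + L) ^ M) ^ 2 * (R ^ 2 * (1 + Real.log (R ^ 2)) ^ B)
      ≤ ((2 * X) ^ M) ^ 2 * (R ^ 2 * (2 * X) ^ B) := by gcongr
    _ = N ^ τ * (2 * X) ^ (2 * M + B) := by
        rw [hR]
        ring
    _ ≤ N ^ τ * N ^ (1 - τ) := by gcongr
    _ = N := by
        rw [← Real.rpow_add hN0]
        simp

lemma prime_error_le {N X L C : ℝ} {M B : ℕ} (hX : 1 ≤ X) (hL0 : 0 ≤ L) (hLX : 1 + L ≤ 2 * X)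
    (hC : 0 ≤ C) (hN : 1 ≤ N) (hlogN : Real.log N = X) (h2N : Real.log (2 * N) ≤ X + 1)
    (h : 7 * 2 ^ (4 * M + B) * C ≤ X) :
    ((1 + L) ^ M) ^ 2 * √(N * (3 * Real.log (2 * N) + 1) * (1 + Real.log N) ^ B *
      (C * (N / Real.log N ^ ((4 * M + B + 2 : ℕ) : ℝ)))) ≤ N := by
  have hN0 : 0 < N := by linarith
  have hlog2N : 0 ≤ Real.log (2 * N) := Real.log_nonneg (by linarith)
  have hX0 : 0 < X := by linarith
  rw [hlogN, Real.rpow_natCast]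
  refine le_of_sq_le_sq ?_ hN0.le
  rw [mul_pow, Real.sq_sqrt (by positivity)]
  calc (((1 + L) ^ M) ^ 2) ^ 2 * (N * (3 * Real.log (2 * N) + 1) * (1 + X) ^ B *
        (C * (N / X ^ (4 * M + B + 2))))
      ≤ (((2 * X) ^ M) ^ 2) ^ 2 * (N * (7 * X) * (2 * X) ^ B *
        (C * (N / X ^ (4 * M + B + 2)))) := by
        gcongr
        · linarith
        · linarith
    -- The squared error carries `X^(4M)` from the weights, `X^B` from the divisor sum and `X` from
    -- the trivial bound; saving `X^(4M+B+2)` leaves one factor `1/X`.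
    _ = N ^ 2 * ((7 * 2 ^ (4 * M + B) * C) / X) := by
        field_simp
        ring
    _ ≤ N ^ 2 * 1 := by
        gcongr
        rwa [div_le_one hX0]
    _ = N ^ 2 := mul_one _

/-! ### Bounded gaps -/

set_option maxHeartbeats 800000 in
/-- The primes have bounded gaps if they have a level of distribution exceeding `1/2`. -/
lemma exists_close_primes {θ : ℝ} (hθ : 1 / 2 < θ) (hθ1 : θ < 1) :
    ∃ H : ℕ, HasLevelOfDistribution θ →
      ∀ n₀ : ℕ, ∃ p q : ℕ, p.Prime ∧ q.Prime ∧ n₀ < p ∧ p < q ∧ q ≤ p + H := by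
  -- The gap between `τ` and `θ` leaves `N^(θ-τ)` to absorb the factor `W` in the moduli.
  set τ := (1 / 2 + θ) / 2 with hτdef
  have hτ : 1 / 2 < τ := by linarith
  have hτθ : τ < θ := by linarith
  obtain ⟨l, m, D, hm, hD, hexp⟩ := exists_sieve_parameters hτ
  set k := m + 2 with hk
  set W := D.factorial with hWdef
  have hW : 0 < W := Nat.factorial_pos D
  have hW' : (0 : ℝ) < W := by exact_mod_cast hW
  have hφ : (0 : ℝ) < W.totient := by exact_mod_cast Nat.totient_pos.2 hW
  -- The bound is fixed before the level of distribution is used, so it depends on `θ` alone.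
  refine ⟨k * W, fun hlevel n₀ => ?_⟩
  by_contra hcon
  push Not at hcon
  set c : ℝ := (W.totient : ℝ) / W with hc
  set lam := τ / 2 with hlam
  have hlam0 : 0 < lam := by linarith
  set M := l + 2 * k with hM
  set B := 2 * (12 * (k - 1)) ^ 2 with hB
  obtain ⟨C, hC⟩ := hlevel ((4 * M + B + 2 : ℕ) : ℝ) (by positivity)
  obtain ⟨C₁, hC₁, hf⟩ := coprimeSum_asymptotic hW (2 * l) (m + 1)
  obtain ⟨C₂, hC₂, hg⟩ := coprimeSum_asymptotic hW (2 * (l + 1)) m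
  set e := Real.exp (2 * (k : ℝ) ^ 2 / D) with he
  have hmt := main_term_lt hm hφ hW' hlam0 hexp
  rw [← hc] at hmt
  set αf : ℝ := c ^ (m + 1 + 1) * ((2 * l).factorial / (2 * l + (m + 1) + 1).factorial) with hαf
  set αg : ℝ := c ^ (m + 1) * ((2 * (l + 1)).factorial / (2 * (l + 1) + m + 1).factorial) with hαg
  set b : ℝ := 1 / W * e * αf * lam ^ (2 * l + m + 2) with hb
  set a : ℝ := k * (1 / W.totient * (c / (l + 1)) ^ 2 * αg * lam ^ (2 * l + m + 3)) with ha
  have hc0 : 0 < c := by positivity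
  have he0 : 0 < e := Real.exp_pos _
  have hαf0 : 0 < αf := by positivity
  have hαg0 : 0 < αg := by positivity
  have hb0 : 0 ≤ b := by positivity
  set K₁ : ℝ := 1 / W * e * C₁ * 2 ^ (2 * l + m + 1) with hK₁
  set K₂ : ℝ := k * (1 / W.totient * (c / (l + 1)) ^ 2 * C₂ * 2 ^ (2 * l + m + 2)) with hK₂
  have hK₁0 : 0 ≤ K₁ := by positivity
  -- The constant supplied by the hypothesis could be negative, while the error bound must be
  -- nonnegative.
  set C' := max C 0 with hC'
  have hcast : Filter.Tendsto (fun N : ℕ => (N : ℝ)) Filter.atTop Filter.atTop :=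
    tendsto_natCast_atTop_atTop
  have hlogt : Filter.Tendsto (fun N : ℕ => Real.log N) Filter.atTop Filter.atTop :=
    Real.tendsto_log_atTop.comp hcast
  have ev1 := hlogt.eventually_ge_atTop 1
  have ev2 := hlogt.eventually_gt_atTop ((K₂ + k + 3 * b + 4 * K₁ + 2) / (a - b))
  have ev3 := hlogt.eventually_ge_atTop (7 * 2 ^ (4 * M + B) * C')
  have ev4 : ∀ᶠ N : ℕ in Filter.atTop, (2 * Real.log N) ^ (2 * M + 12 * k) ≤ (N : ℝ) ^ (1 - τ) := by
    have h1 := (isLittleO_log_rpow_rpow_atTop (s := 1 - τ) ((2 * M + 12 * k : ℕ) : ℝ)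
      (by linarith)).bound (show (0 : ℝ) < (2 ^ (2 * M + 12 * k))⁻¹ by positivity)
    filter_upwards [hcast.eventually h1, ev1] with N hN hN1
    rw [Real.rpow_natCast, Real.norm_of_nonneg (by positivity), Real.norm_of_nonneg (by positivity),
      inv_mul_eq_div, le_div_iff₀ (by positivity)] at hN
    rw [mul_pow, mul_comm]
    exact hN
  have ev5 : ∀ᶠ N : ℕ in Filter.atTop, (W : ℝ) ≤ (N : ℝ) ^ (θ - τ) :=
    ((tendsto_rpow_atTop (show 0 < θ - τ by linarith)).comp hcast).eventually_ge_atTop _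
  have ev6 : ∀ᶠ N : ℕ in Filter.atTop, (k * W : ℝ) * Real.log N ≤ N := by
    have h1 := Real.isLittleO_log_id_atTop.bound
      (show (0 : ℝ) < ((k * W : ℝ))⁻¹ by positivity)
    filter_upwards [hcast.eventually h1, ev1] with N hN hN1
    rw [Real.norm_of_nonneg (by linarith), id, Real.norm_of_nonneg (by positivity),
      inv_mul_eq_div, le_div_iff₀ (by positivity)] at hN
    linarith
  -- The condition `N ≥ n₀ + k W` puts every `n > N - k W` beyond `n₀`, where two primes in one
  -- tuple would contradict `hcon`.
  obtain ⟨N, hX1, hX2, hX3, hX4, hX5, hX6, hN0, hN2⟩ := (ev1.and (ev2.and (ev3.and (ev4.and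
    (ev5.and (ev6.and ((Filter.eventually_ge_atTop (n₀ + k * W)).and
      (Filter.eventually_ge_atTop 2)))))))).exists
  set X := Real.log N with hX
  have hN2' : (2 : ℝ) ≤ N := by exact_mod_cast hN2
  have hNpos : (0 : ℝ) < N := by linarith
  set R : ℝ := (N : ℝ) ^ lam with hR
  have hR2 : R ^ 2 = (N : ℝ) ^ τ := by
    rw [hR, ← Real.rpow_natCast, ← Real.rpow_mul hNpos.le, hlam]
    congr 1
    push_cast
    ring
  have hlogR : Real.log R = lam * X := Real.log_rpow hNpos _
  have hR1 : 1 ≤ R := Real.one_le_rpow (by linarith) hlam0.le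
  have hRN : R ≤ N := by
    calc R ≤ (N : ℝ) ^ (1 : ℝ) :=
          Real.rpow_le_rpow_of_exponent_le (by linarith) (by linarith)
      _ = N := Real.rpow_one _
  have hlogR2 : Real.log (R ^ 2) = τ * X := by rw [hR2, Real.log_rpow hNpos]
  have hkWN : (k * W : ℝ) ≤ N := le_trans (le_mul_of_one_le_right (by positivity) hX1) hX6
  have hWR : (W : ℝ) * R ^ 2 ≤ (N : ℝ) ^ θ := by
    rw [hR2]
    calc (W : ℝ) * (N : ℝ) ^ τ ≤ (N : ℝ) ^ (θ - τ) * (N : ℝ) ^ τ := by gcongr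
      _ = _ := by
        rw [← Real.rpow_add hNpos]
        congr 1
        ring
  have h2N : Real.log (2 * N) ≤ X + 1 := by
    rw [Real.log_mul (by norm_num) hNpos.ne']
    have := Real.log_two_lt_d9
    linarith
  have hlog2N : 0 ≤ Real.log (2 * N) := Real.log_nonneg (by linarith)
  have hone : ∀ n, N - k * W < n → ∀ i < k, ∀ j < k,
      (n + i * W).Prime → (n + j * W).Prime → i = j := by
    have key : ∀ n, N - k * W < n → ∀ i < k, ∀ j < k,
        (n + i * W).Prime → (n + j * W).Prime → ¬ i < j := by
      intro n hn i hi j hj hpi hpj hij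
      have h1 : i * W < j * W := Nat.mul_lt_mul_of_pos_right hij hW
      have h2 : j * W ≤ k * W := Nat.mul_le_mul_right _ hj.le
      have := hcon _ _ hpi hpj (by omega) (by omega)
      omega
    intro n hn i hi j hj hpi hpj
    rcases lt_trichotomy i j with h | h | h
    · exact absurd h (key n hn i hi j hj hpi hpj)
    · exact h
    · exact absurd h (key n hn j hj i hi hpj hpi)
  have hineq := sieve_inequality (k := k) (D := D) (l := l) (N := N) (R := R) (θ := θ)
    (E := C' * (N / X ^ ((4 * M + B + 2 : ℕ) : ℝ))) (by omega) hD hR1 hRN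
    (by exact_mod_cast hkWN) hθ1.le hWR (mul_nonneg (le_max_right _ _) (by positivity))
    ((hC N hN2').trans (ENNReal.ofReal_le_ofReal
      (mul_le_mul_of_nonneg_right (le_max_left _ _) (by positivity)))) hone
  rw [← hWdef, ← hc, ← he, ← hM, ← hB] at hineq
  set L := Real.log R with hL
  have hL0 : 0 ≤ L := Real.log_nonneg hR1
  have hLX : 1 + L ≤ 2 * X := by
    have : lam * X ≤ 1 * X := mul_le_mul_of_nonneg_right (by linarith) (by linarith)
    rw [hlogR]
    linarith
  have hRX : 1 + Real.log (R ^ 2) ≤ 2 * X := by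
    have : τ * X ≤ 1 * X := mul_le_mul_of_nonneg_right (by linarith) (by linarith)
    rw [hlogR2]
    linarith
  have herr1 := counting_error_le (N := N) (X := X) (L := L) (R := R) (τ := τ) (M := M)
    (B := 12 * k) hX1 hL0 hLX (Real.log_nonneg (one_le_pow₀ hR1))
    hRX hR2 (by linarith) hX4
  have herr2 := prime_error_le (N := N) (X := X) (L := L) (C := C') (M := M) (B := B) hX1 hL0 hLX
    (le_max_right _ _) (by linarith) hX.symm h2N hX3
  rw [← hX] at herr2
  have hTf : coprimeSum W (2 * l) k R ≤
      αf * (lam * X) ^ (2 * l + m + 2) + C₁ * (2 * X) ^ (2 * l + m + 1) := by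
    have h1 := sub_le_iff_le_add.1 (abs_le.1 (hf R hR1)).2
    rw [← hL] at h1
    have h2 : C₁ * (1 + L) ^ (2 * l + (m + 1)) ≤ C₁ * (2 * X) ^ (2 * l + m + 1) := by
      rw [← add_assoc]
      gcongr
    have e1 : 2 * l + (m + 1) + 1 = 2 * l + m + 2 := by ring
    rw [← hlogR]
    rw [e1] at h1
    linarith
  have hTg : αg * (lam * X) ^ (2 * l + m + 3) - C₂ * (2 * X) ^ (2 * l + m + 2) ≤
      coprimeSum W (2 * (l + 1)) (k - 1) R := by
    have h1 := (abs_le.1 (hg R hR1)).1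
    rw [← hL] at h1
    have e1 : 2 * (l + 1) + m + 1 = 2 * l + m + 3 := by ring
    have e2 : 2 * (l + 1) + m = 2 * l + m + 2 := by ring
    have h2 : C₂ * (1 + L) ^ (2 * (l + 1) + m) ≤ C₂ * (2 * X) ^ (2 * l + m + 2) := by
      rw [e2]
      gcongr
    have e3 : k - 1 = m + 1 := by omega
    rw [e3, ← hlogR]
    rw [e1] at h1
    linarith
  have hlow : (N : ℝ) * (a * X ^ (2 * l + m + 1 + 2) - K₂ * X ^ (2 * l + m + 1 + 1) - k) ≤
      (k : ℝ) * ((N : ℝ) / W.totient *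
        ((c / (l + 1)) ^ 2 * coprimeSum W (2 * (l + 1)) (k - 1) R) - N) := by
    have h1 : (k : ℝ) * ((N : ℝ) / W.totient * ((c / (l + 1)) ^ 2 *
        (αg * (lam * X) ^ (2 * l + m + 3) - C₂ * (2 * X) ^ (2 * l + m + 2))) - N) ≤ _ :=
      mul_le_mul_of_nonneg_left (sub_le_sub_right (mul_le_mul_of_nonneg_left
        (mul_le_mul_of_nonneg_left hTg (sq_nonneg _)) (by positivity)) _) (by positivity)
    refine le_trans (le_of_eq ?_) h1
    rw [ha, hK₂, mul_pow, mul_pow]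
    ring
  have hupp : Real.log (2 * N) * (((N : ℝ) + k * W) / W * (e * coprimeSum W (2 * l) k R) + N) ≤
      N * ((X + 1) * ((1 + 1 / X) * (b * X ^ (2 * l + m + 1 + 1) + K₁ * X ^ (2 * l + m + 1)) + 1)) := by
    have h1 : (N : ℝ) + k * W ≤ N * (1 + 1 / X) := by
      have : (k * W : ℝ) ≤ N / X := by rwa [le_div_iff₀ (by linarith)]
      calc (N : ℝ) + k * W ≤ N + N / X := by gcongr
        _ = _ := by ring
    have h0 := coprimeSum_nonneg W (2 * l) k R
    calc _ ≤ (X + 1) * ((N * (1 + 1 / X)) / W * (e *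
          (αf * (lam * X) ^ (2 * l + m + 2) + C₁ * (2 * X) ^ (2 * l + m + 1))) + N) := by
          gcongr
      _ = _ := by
          rw [hb, hK₁, mul_pow, mul_pow]
          ring
  have hfin := mul_pow_lt_of_lt (a := a) (b := b) (C₁ := K₁) (C₂ := K₂) (C₃ := k) (X := X)
    (2 * l + m + 1) hb0 hK₁0 (by positivity) hX1 (by
      rw [div_lt_iff₀ (by linarith)] at hX2
      linarith)
  have hA : (k : ℝ) * ((N : ℝ) / W.totient *
        ((c / (l + 1)) ^ 2 * coprimeSum W (2 * (l + 1)) (k - 1) R) - N) ≤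
      Real.log (2 * N) * (((N : ℝ) + k * W) / W * (e * coprimeSum W (2 * l) k R) + N) := by
    refine le_trans ?_ (hineq.trans ?_)
    · refine mul_le_mul_of_nonneg_left ?_ (by positivity)
      linarith
    · refine mul_le_mul_of_nonneg_left ?_ hlog2N
      linarith
  have := (hlow.trans hA).trans hupp
  have h3 := le_of_mul_le_mul_left this hNpos
  linarith

lemma nth_prime_succ_le {p q : ℕ} (hp : p.Prime) (hq : q.Prime) (hpq : p < q) :
    Nat.nth Nat.Prime (Nat.count Nat.Prime p + 1) ≤ q := by
  have h1 : Nat.count Nat.Prime p < Nat.count Nat.Prime q := Nat.count_strict_mono hp hpq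
  calc Nat.nth Nat.Prime (Nat.count Nat.Prime p + 1) ≤ Nat.nth Nat.Prime (Nat.count Nat.Prime q) :=
        (Nat.nth_monotone Nat.infinite_setOfPred_prime) h1
    _ = q := Nat.nth_count hq

end BoundedGaps

theorem mainTheorem3 :
    ∃ c : ℝ → ℝ, ∀ θ : ℝ, 1 / 2 < θ → θ < 1 → HasLevelOfDistribution θ →
      {n : ℕ | (Nat.nth Nat.Prime (n + 1) : ℝ) - (Nat.nth Nat.Prime n : ℝ) ≤ c θ}.Infinite := by
  -- All hypotheses stand inside the existential, so that `choose` yields a function of `θ` alone.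
  have h : ∀ θ : ℝ, ∃ H : ℕ, 1 / 2 < θ → θ < 1 → HasLevelOfDistribution θ →
      ∀ n₀ : ℕ, ∃ p q : ℕ, p.Prime ∧ q.Prime ∧ n₀ < p ∧ p < q ∧ q ≤ p + H := by
    intro θ
    by_cases hθ : 1 / 2 < θ ∧ θ < 1
    · obtain ⟨H, hH⟩ := exists_close_primes hθ.1 hθ.2
      exact ⟨H, fun _ _ => hH⟩
    · exact ⟨0, fun h1 h2 => absurd ⟨h1, h2⟩ hθ⟩
  choose H hH using h
  refine ⟨fun θ => H θ, fun θ h1 h2 h3 => Set.infinite_of_forall_exists_gt fun n => ?_⟩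
  -- The prime `p` lies beyond the `n`th one, so its index exceeds `n`; the prime following `p` is
  -- at most `q`.
  obtain ⟨p, q, hp, hq, hn, hpq, hqp⟩ := hH θ h1 h2 h3 (Nat.nth Nat.Prime n)
  refine ⟨Nat.count Nat.Prime p, ?_, ?_⟩
  · have h4 := (nth_prime_succ_le hp hq hpq).trans hqp
    have h5 : (Nat.nth Nat.Prime (Nat.count Nat.Prime p + 1) : ℝ) ≤ p + H θ := by exact_mod_cast h4
    rw [Set.mem_ofPred_eq, Nat.nth_count hp]
    linarith
  · have h4 := Nat.count_strict_mono (Nat.prime_nth_prime n) hn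
    rwa [Nat.count_nth_of_infinite Nat.infinite_setOfPred_prime] at h4
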